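/- Let $E$ be a locally convex Hausdorff topological real vector space, $E_+\subset E$ a closed convex cone (with $0\in E_+$), and endow $E$ with the preorder $x\le y :\Leftrightarrow y-x\in E_+$ and its Borel $\sigma$-algebra. For $A\subset E$ put ${\uparrow}A:=\{y\in E: x\le y \text{ for some } x\in A\}$; $A$ is an upset if $A={\uparrow}A$. Let $E_+^*$ be the set of continuous linear functionals $\mu$ on $E$ with $\mu\ge 0$ on $E_+$. Let $(\xi_n)_{n\ge 1}$ be an i.i.d. sequence of $E$-valued random variables on a probability space $(\Omega,\mathcal F,\mathbb P)$ whose sample means $X_n:=\frac1n\sum_{i=1}^n\xi_i$ are random variables (Borel measurable). An $E$-valued random variable $Y$ is called convex tight if for every $\varepsilon>0$ there is a convex compact $K\subset E$ with $\mathbb P(Y\in K)\ge 1-\varepsilon$. For every open or closed upset $A$ let $J_A:=\limsup_{n\to\infty}\frac1n\log\mathbb P(X_n\in A)\in[-\infty,0]$ (with $\log 0=-\infty$). Let $L^\uparrow$ be the set of increasing lower semicontinuous functions $f:E\to[-\infty,\infty)$, let $\phi_J(f):=\sup_{c\in\mathbb R}\{c+J_{\{f>c\}}\}$ for $f\in L^\uparrow$,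 and define the minimal rate function $$I_{\min}(x):=\sup_{f\in L^\uparrow}\{f(x)-\phi_J(f)\},\qquad x\in E,$$ where $(-\infty)-(-\infty):=-\infty$. Let $\Lambda(\mu):=\log\mathbb E[\exp(\mu(\xi_1))]\in(-\infty,\infty]$ for $\mu\in E_+^*$. Suppose that $\xi_1$ is convex tight. Then $$I_{\min}(x)=\sup_{\mu\in E_+^*}\{\mu(x)-\Lambda(\mu)\}\qquad\text{for all }x\in E.$$ Moreover, $$\limsup_{n\to\infty}\tfrac1n\log\mathbb P(X_n\in C)\le-\inf_{x\in C}I_{\min}(x)$$ for all closed upsets $C\subset E$ that are compactly generated, i.e. $C={\uparrow}K$ for some compact $K\subset E$. If additionally $X_n$ is convex tight for every $n\ge 1$, then for all convex open upsets $O\subset E$ the limit $\lim_{n\to\infty}\frac1n\log\mathbb P(X_n\in O)$ exists in $[-\infty,0]$ and $$\lim_{n\to\infty}\tfrac1n\log\mathbb P(X_n\in O)=-\inf_{x\in O}I_{\min}(x).$$ (Here $\inf\emptyset=+\infty$.) -/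

import Mathlib

open Filter Topology MeasureTheory ProbabilityTheory
open scoped ENNReal

noncomputable section

/-- `L↑`: the increasing lower semicontinuous functions `f : E → [-∞, ∞)`. -/
def lscIncreasing (E : Type*) [TopologicalSpace E] [Preorder E] : Set (E → EReal) :=
  {f | Monotone f ∧ LowerSemicontinuous f ∧ ∀ x, f x ≠ ⊤}

/-- The maxitive integral `φ_J(f) = sup_{c ∈ ℝ} (c + J_{f > c})` of a function `f ∈ L↑` with respect
to a set function `J`. -/
def maxitiveIntegral {E : Type*} (J : Set E → EReal) (f : E → EReal) : EReal :=
  ⨆ c : ℝ, (c : EReal) + J {x | (c : EReal) < f x}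

/-- The minimal rate function `I_min(x) = sup_{f ∈ L↑} (f(x) - φ_J(f))` of a concentration `J`.
The indeterminate expression `(-∞) - (-∞)` evaluates to `-∞` in `EReal`, so that it does not
contribute to the supremum. -/
def minimalRate {E : Type*} [TopologicalSpace E] [Preorder E] (J : Set E → EReal) (x : E) :
    EReal :=
  ⨆ f ∈ lscIncreasing E, f x - maxitiveIntegral J f

/-- A set is a compactly generated upset if it is the upset `↑K = {y | ∃ x ∈ K, x ≤ y}` of a compact
set `K`. -/
def IsCompactlyGeneratedUpset {E : Type*} [TopologicalSpace E] [Preorder E] (A : Set E) : Prop :=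
  ∃ K : Set E, IsCompact K ∧ A = {y | ∃ x ∈ K, x ≤ y}

section Probability

variable {Ω : Type*} [MeasurableSpace Ω]

/-- The sample mean `X_n = (1/n) (ξ_1 + ⋯ + ξ_n)`; the sequence is indexed from `0`, i.e. `ξ i` is
the `(i+1)`-st variable. (`X_0 = 0` is a dummy value.) -/
def sampleMean {E : Type*} [AddCommGroup E] [Module ℝ E] (ξ : ℕ → Ω → E) (n : ℕ) (ω : Ω) : E :=
  (n : ℝ)⁻¹ • ∑ i ∈ Finset.range n, ξ i ω

/-- `(1/n) log ℙ(Y ∈ A)`, with value in `[-∞, 0]`, where `log 0 = -∞`. -/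
def scaledLogProb {E : Type*} (P : Measure Ω) (n : ℕ) (Y : Ω → E) (A : Set E) : EReal :=
  (((n : ℝ)⁻¹ : ℝ) : EReal) * ENNReal.log (P (Y ⁻¹' A))

/-- The asymptotic concentration `J_A = limsup_n (1/n) log ℙ(X_n ∈ A)` of the sample means. -/
def sampleConcentration {E : Type*} [AddCommGroup E] [Module ℝ E] (P : Measure Ω)
    (ξ : ℕ → Ω → E) (A : Set E) : EReal :=
  limsup (fun n : ℕ => scaledLogProb P n (sampleMean ξ n) A) atTop

/-- A random variable `Y` is convex tight if for every `ε > 0` there is a convex compact set `K`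
with `ℙ(Y ∈ K) ≥ 1 - ε`. -/
def IsConvexTight {E : Type*} [AddCommGroup E] [Module ℝ E] [TopologicalSpace E]
    (P : Measure Ω) (Y : Ω → E) : Prop :=
  ∀ ε : ℝ, 0 < ε → ∃ K : Set E, Convex ℝ K ∧ IsCompact K ∧ 1 - ENNReal.ofReal ε ≤ P (Y ⁻¹' K)

/-- The logarithmic moment generating function `Λ(μ) = log 𝔼[exp(μ(Y))]`, with value in
`(-∞, ∞]`. -/
def logMGF {E : Type*} [AddCommGroup E] [Module ℝ E] [TopologicalSpace E]
    (P : Measure Ω) (Y : Ω → E) (μ : E →L[ℝ] ℝ) : EReal :=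
  ENNReal.log (∫⁻ ω, ENNReal.ofReal (Real.exp (μ (Y ω))) ∂P)

end Probability

end

/-! Write `Λ*` for the conjugate of `Λ` over the positive functionals. The theorem reduces to `I_min
= Λ*` together with bounds on probabilities in terms of `Λ*`.

Upper bounds come from Chernoff's inequality `measure_le_map_sampleMean_le`: if `Λ(ν) ≤ r`, the
half-space `ν ≥ r + α` has probability at most `exp(-nα)`. Testing `minimalRate` with `f = ν` turns
this into `Λ* ≤ I_min`. For `↑K`, compactness of `K` and positivity of `ν` leave finitely many
half-spaces. On a convex compact set, the minimax argument of `exists_forall_lt_of_isCompact` merges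
them into one, so the bound has no prefactor and holds for each `n`; tightness of `X_n` then carries
it to convex open sets.

The lower bound `eventually_le_measure_sampleMean` says that a convex open upset around `x` has
exponential rate at least `-Λ*(x)`. Confine all `ξ i` to a convex compact `K`; then `K \ O` is cut
off by finitely many positive functionals, and the problem is finite-dimensional. Tilting by the
minimizer of `∫_K exp(∑ l_j f_j)` over `l ≥ 0` makes all tilted means of the `f_j` nonnegative
(`eventually_le_measure_sums`). The infinite-dimensional work is to find one `K` on which the bound
on `Λ` survives uniformly enough (`exists_convex_isCompact_lt_expIntegral`): Hahn-Banach and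
barycenters give coercivity, Banach-Alaoglu gives compactness. Since an open upset `{f > c}`
contains a convex open upset around each of its points, `I_min ≤ Λ*` follows. -/

/-! ### Exponential tilting and a finite-dimensional Cramér lower bound. -/

section Tilting

variable {S Ω : Type*} [MeasurableSpace S] [MeasurableSpace Ω]

/-- The exponential integral `∫_K exp(u) dρ`. -/
noncomputable def expIntegral (ρ : Measure S) (K : Set S) (u : S → ℝ) : ℝ≥0∞ :=
  ∫⁻ y in K, ENNReal.ofReal (Real.exp (u y)) ∂ρ

lemma lintegral_prod_indicator_exp {P : Measure Ω} {ξ : ℕ → Ω → S}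
    (hm : ∀ i, Measurable (ξ i)) (hi : iIndepFun ξ P) (hid : ∀ i, IdentDistrib (ξ i) (ξ 0) P P)
    {K : Set S} (hK : MeasurableSet K) {u : S → ℝ} (hu : Measurable u) (n : ℕ) :
    ∫⁻ ω, ∏ i ∈ Finset.range n,
        K.indicator (fun y => ENNReal.ofReal (Real.exp (u y))) (ξ i ω) ∂P
      = expIntegral (P.map (ξ 0)) K u ^ n := by
  have hf : Measurable (K.indicator (fun y => ENNReal.ofReal (Real.exp (u y)))) :=
    Measurable.indicator (by fun_prop) hK
  have h1 := lintegral_prod_eq_prod_lintegral_of_indepFun (μ := P) (Finset.range n)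
    (fun i ω => K.indicator (fun y => ENNReal.ofReal (Real.exp (u y))) (ξ i ω))
    (hi.comp _ (fun _ => hf)) (fun i => hf.comp (hm i))
  rw [h1]
  have h2 : ∀ i, ∫⁻ ω, K.indicator (fun y => ENNReal.ofReal (Real.exp (u y))) (ξ i ω) ∂P
      = expIntegral (P.map (ξ 0)) K u := by
    intro i
    rw [expIntegral, ← lintegral_indicator hK, ← (hid i).map_eq, lintegral_map hf (hm i)]
  simp [h2]

lemma prod_indicator_exp_of_mem {S : Type*} {K : Set S} (u : S → ℝ) {x : ℕ → S} {n : ℕ}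
    (h : ∀ i < n, x i ∈ K) :
    ∏ i ∈ Finset.range n, K.indicator (fun y => ENNReal.ofReal (Real.exp (u y))) (x i)
      = ENNReal.ofReal (Real.exp (∑ i ∈ Finset.range n, u (x i))) := by
  rw [Real.exp_sum, ENNReal.ofReal_prod_of_nonneg (fun _ _ => (Real.exp_pos _).le)]
  refine Finset.prod_congr rfl fun i hi => ?_
  rw [Set.indicator_of_mem (h i (Finset.mem_range.1 hi))]

/-- Split `Z^n`, the integral of `exp(∑ g)` over paths in `K`, according to `G`. The member `h j₀ =
-g` forces `∑ g < nδ` on `G`. Off `G` some sum of `h j` is at most `-nδ`, so Markov's trick inserts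
the factor `exp(-s j (nδ + ∑ h j)) ≥ 1`. -/
lemma expIntegral_pow_le {P : Measure Ω} {ξ : ℕ → Ω → S}
    (hm : ∀ i, Measurable (ξ i)) (hi : iIndepFun ξ P) (hid : ∀ i, IdentDistrib (ξ i) (ξ 0) P P)
    {K : Set S} (hK : MeasurableSet K) {ι : Type*} [Fintype ι] {h : ι → S → ℝ}
    (hh : ∀ j, Measurable (h j)) {g : S → ℝ} (hg : Measurable g) {j₀ : ι} (hj₀ : h j₀ = -g)
    (s : ι → ℝ) (hs : ∀ j, 0 < s j) (δ : ℝ) (n : ℕ) :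
    expIntegral (P.map (ξ 0)) K g ^ n ≤ ENNReal.ofReal (Real.exp (n * δ))
        * P {ω | (∀ i < n, ξ i ω ∈ K) ∧ ∀ j, -(n * δ) < ∑ i ∈ Finset.range n, h j (ξ i ω)}
      + ∑ j, (ENNReal.ofReal (Real.exp (-(s j * δ)))
          * expIntegral (P.map (ξ 0)) K (g - s j • h j)) ^ n := by
  set G := {ω | (∀ i < n, ξ i ω ∈ K) ∧ ∀ j, -(n * δ) < ∑ i ∈ Finset.range n, h j (ξ i ω)}
  have hu : ∀ j, Measurable (g - s j • h j) := fun j => hg.sub ((hh j).const_smul _)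
  have hmeas : ∀ j, Measurable fun ω => ∏ i ∈ Finset.range n,
      K.indicator (fun y => ENNReal.ofReal (Real.exp ((g - s j • h j) y))) (ξ i ω) := by
    intro j
    refine Finset.measurable_prod _ fun i _ => ?_
    refine Measurable.comp (Measurable.indicator ?_ hK) (hm i)
    exact ENNReal.measurable_ofReal.comp (Real.measurable_exp.comp (hu j))
  rw [← lintegral_prod_indicator_exp hm hi hid hK hg]
  calc _ ≤ ∫⁻ ω, (G.indicator (fun _ => ENNReal.ofReal (Real.exp (n * δ))) ω
        + ∑ j, ENNReal.ofReal (Real.exp (-(s j * δ))) ^ n * ∏ i ∈ Finset.range n,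
          K.indicator (fun y => ENNReal.ofReal (Real.exp ((g - s j • h j) y))) (ξ i ω)) ∂P := by
        refine lintegral_mono fun ω => ?_
        by_cases hω : ∀ i < n, ξ i ω ∈ K
        swap
        · push Not at hω
          obtain ⟨i, hin, hiK⟩ := hω
          have : ∏ i ∈ Finset.range n,
              K.indicator (fun y => ENNReal.ofReal (Real.exp (g y))) (ξ i ω) = 0 :=
            Finset.prod_eq_zero (Finset.mem_range.2 hin) (Set.indicator_of_notMem hiK _)
          simp only [this, zero_le]
        · simp only [prod_indicator_exp_of_mem _ hω]
          by_cases hG : ∀ j, -(n * δ) < ∑ i ∈ Finset.range n, h j (ξ i ω)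
          · refine le_add_right ?_
            rw [Set.indicator_of_mem (show ω ∈ G from ⟨hω, hG⟩)]
            have := hG j₀
            simp only [hj₀, Pi.neg_apply, Finset.sum_neg_distrib] at this
            gcongr
            linarith
          · push Not at hG
            obtain ⟨j, hj⟩ := hG
            refine le_add_left ?_
            refine le_trans ?_ (Finset.single_le_sum (f := fun j =>
              ENNReal.ofReal (Real.exp (-(s j * δ))) ^ n * ENNReal.ofReal
                (Real.exp (∑ i ∈ Finset.range n, (g - s j • h j) (ξ i ω))))
              (fun _ _ => zero_le) (Finset.mem_univ j))
            rw [← ENNReal.ofReal_pow (Real.exp_pos _).le, ← Real.exp_nat_mul,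
              ← ENNReal.ofReal_mul (Real.exp_pos _).le, ← Real.exp_add]
            gcongr
            simp only [Pi.sub_apply, Pi.smul_apply, smul_eq_mul, Finset.sum_sub_distrib,
              ← Finset.mul_sum]
            nlinarith [mul_le_mul_of_nonneg_left hj (hs j).le]
    _ = ∫⁻ ω, G.indicator (fun _ => ENNReal.ofReal (Real.exp (n * δ))) ω ∂P
        + ∑ j, ENNReal.ofReal (Real.exp (-(s j * δ))) ^ n
          * expIntegral (P.map (ξ 0)) K (g - s j • h j) ^ n := by
        rw [lintegral_add_right _ (Finset.measurable_sum _ fun j _ => (hmeas j).const_mul _),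
          lintegral_finsetSum _ fun j _ => (hmeas j).const_mul _]
        congr 1
        refine Finset.sum_congr rfl fun j _ => ?_
        rw [lintegral_const_mul _ (hmeas j), lintegral_prod_indicator_exp hm hi hid hK (hu j)]
    _ ≤ _ := by
        simp only [mul_pow]
        gcongr
        exact lintegral_indicator_const_le _ _

/-- Change of measure: lower bound for the probability that the sums of the `h j` stay above `-nδ`
under exponential tilting by `g`. -/
lemma eventually_le_measure_of_tilt {P : Measure Ω} {ξ : ℕ → Ω → S}
    (hm : ∀ i, Measurable (ξ i)) (hi : iIndepFun ξ P) (hid : ∀ i, IdentDistrib (ξ i) (ξ 0) P P)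
    {K : Set S} (hK : MeasurableSet K) {ι : Type*} [Fintype ι] {h : ι → S → ℝ}
    (hh : ∀ j, Measurable (h j)) {g : S → ℝ} (hg : Measurable g) {j₀ : ι} (hj₀ : h j₀ = -g)
    {β δ : ℝ} (hfin : expIntegral (P.map (ξ 0)) K g ≠ ⊤)
    (hβ : ENNReal.ofReal (Real.exp (β + δ)) < expIntegral (P.map (ξ 0)) K g)
    (hs : ∀ j, ∃ s > 0, ENNReal.ofReal (Real.exp (-(s * δ)))
      * expIntegral (P.map (ξ 0)) K (g - s • h j) < expIntegral (P.map (ξ 0)) K g) :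
    ∀ᶠ n : ℕ in atTop, ENNReal.ofReal (Real.exp (n * β)) ≤
      P {ω | (∀ i < n, ξ i ω ∈ K) ∧ ∀ j, -(n * δ) < ∑ i ∈ Finset.range n, h j (ξ i ω)} := by
  choose s hs0 hs using hs
  set Z := expIntegral (P.map (ξ 0)) K g
  have hZ0 : Z ≠ 0 := (zero_le.trans_lt hβ).ne'
  have key : ∀ q : ℝ≥0∞, q < Z → Tendsto (fun n : ℕ => (q / Z) ^ n) atTop (𝓝 0) := by
    intro q hq
    refine ENNReal.tendsto_pow_atTop_nhds_zero_of_lt_one ?_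
    rw [ENNReal.div_lt_iff (Or.inl hZ0) (Or.inl hfin), one_mul]
    exact hq
  -- After division by `Z^n` all the terms decay geometrically, so eventually the error sum and
  -- `exp(n(β + δ))` together fit below `Z^n`. The error then cancels from `expIntegral_pow_le`,
  -- leaving `exp(n(β + δ)) ≤ exp(nδ) P(G)`.
  have hlim : Tendsto (fun n : ℕ => (ENNReal.ofReal (Real.exp (β + δ)) / Z) ^ n
      + ∑ j, ((ENNReal.ofReal (Real.exp (-(s j * δ)))
          * expIntegral (P.map (ξ 0)) K (g - s j • h j)) / Z) ^ n) atTop (𝓝 0) := by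
    have := (key _ hβ).add (tendsto_finsetSum Finset.univ fun j _ => key _ (hs j))
    simpa using this
  filter_upwards [hlim.eventually_lt_const one_pos] with n hn
  have hZn : Z ^ n ≠ ⊤ := ENNReal.pow_ne_top hfin
  have hZn0 : Z ^ n ≠ 0 := pow_ne_zero _ hZ0
  set A := ∑ j, (ENNReal.ofReal (Real.exp (-(s j * δ)))
          * expIntegral (P.map (ξ 0)) K (g - s j • h j)) ^ n
  have h1 : ENNReal.ofReal (Real.exp (β + δ)) ^ n + A ≤ Z ^ n := by
    have h2 : (ENNReal.ofReal (Real.exp (β + δ)) ^ n + A) / Z ^ n ≤ 1 := by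
      refine le_of_eq_of_le ?_ hn.le
      simp only [A, div_eq_mul_inv, mul_pow, add_mul, Finset.sum_mul, ENNReal.inv_pow]
    have := (ENNReal.div_le_iff hZn0 hZn).1 h2
    simpa using this
  have h3 := h1.trans (expIntegral_pow_le hm hi hid hK hh hg hj₀ s hs0 δ n)
  have hA : A ≠ ⊤ := ne_top_of_le_ne_top hZn (le_add_self.trans h1)
  have h4 := (ENNReal.add_le_add_iff_right hA).1 h3
  rw [← ENNReal.ofReal_pow (Real.exp_pos _).le, ← Real.exp_nat_mul, mul_add, add_comm,
    Real.exp_add, ENNReal.ofReal_mul (Real.exp_pos _).le] at h4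
  exact (ENNReal.mul_le_mul_iff_right (by simp [Real.exp_pos]) ENNReal.ofReal_ne_top).1 h4

/-- To the right of `s = 0` the left side is `2 + O(s²)` and the right side is at least `2 + sδ`. -/
lemma exists_two_mul_cosh_lt {δ : ℝ} (hδ : 0 < δ) (B : ℝ) :
    ∃ s : ℝ, 0 < s ∧ s ≤ 1 ∧ 2 * Real.cosh (s * B) < 1 + Real.exp (s * δ) := by
  have h1 : ∀ᶠ s : ℝ in 𝓝 0, (s * B) ^ 2 / 2 < 1 :=
    (ContinuousAt.tendsto (f := fun s : ℝ => (s * B) ^ 2 / 2) (by fun_prop)).eventually_lt_const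
      (by norm_num)
  have h2 : ∀ᶠ s : ℝ in 𝓝 0, s * B ^ 2 < δ / 2 :=
    (ContinuousAt.tendsto (f := fun s : ℝ => s * B ^ 2) (by fun_prop)).eventually_lt_const
      (by simpa using hδ)
  have h3 : ∀ᶠ s : ℝ in 𝓝 0, s < 1 := eventually_lt_nhds one_pos
  obtain ⟨s, ⟨⟨hs1, hs2⟩, hs3⟩, hs0⟩ :=
    ((((h1.and h2).and h3).filter_mono nhdsWithin_le_nhds).and
      (self_mem_nhdsWithin : Set.Ioi (0 : ℝ) ∈ 𝓝[>] 0)).exists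
  refine ⟨s, hs0, hs3.le, ?_⟩
  have hs0' : 0 < s := hs0
  have hu : 0 ≤ (s * B) ^ 2 / 2 := by positivity
  have h4 := Real.abs_exp_sub_one_le (x := (s * B) ^ 2 / 2) (by rw [abs_of_nonneg hu]; exact hs1.le)
  rw [abs_of_nonneg hu] at h4
  have h5 := (abs_le.1 h4).2
  have h6 := Real.cosh_le_exp_half_sq (s * B)
  have h7 := Real.add_one_le_exp (s * δ)
  have h8 := mul_lt_mul_of_pos_left hs2 hs0'
  nlinarith

/-- A substitute for differentiating under the integral. Since `exp(sh) + exp(-sh) ≤ 2 cosh(sB)` on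
`K`, the integrals for `g + sh` and `g - sh` add up to less than `(1 + exp(sδ)) Z`; the first is at
least `Z` by minimality, so the second is below `exp(sδ) Z`. -/
lemma exists_tilt_lt {ρ : Measure S} {K : Set S} {g h : S → ℝ}
    (hg : Measurable g) (hh : Measurable h) {B δ : ℝ} (hB : ∀ y ∈ K, |h y| ≤ B) (hδ : 0 < δ)
    (hfin : expIntegral ρ K g ≠ ⊤) (hpos : expIntegral ρ K g ≠ 0)
    (hmin : ∀ s : ℝ, 0 < s → s ≤ 1 → expIntegral ρ K g ≤ expIntegral ρ K (g + s • h)) :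
    ∃ s > 0, ENNReal.ofReal (Real.exp (-(s * δ))) * expIntegral ρ K (g - s • h)
      < expIntegral ρ K g := by
  obtain ⟨s, hs0, hs1, hs⟩ := exists_two_mul_cosh_lt hδ B
  refine ⟨s, hs0, ?_⟩
  have hm : Measurable fun y => ENNReal.ofReal (Real.exp ((g + s • h) y)) :=
    ENNReal.measurable_ofReal.comp (Real.measurable_exp.comp (hg.add (hh.const_smul _)))
  have h1 : expIntegral ρ K (g + s • h) + expIntegral ρ K (g - s • h)
      ≤ ENNReal.ofReal (2 * Real.cosh (s * B)) * expIntegral ρ K g := by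
    rw [expIntegral, expIntegral, expIntegral, ← lintegral_add_left hm,
      ← lintegral_const_mul _ (by fun_prop)]
    refine setLIntegral_mono (by fun_prop) fun y hy => ?_
    have h2 : Real.cosh (s * h y) ≤ Real.cosh (s * B) := by
      rw [Real.cosh_le_cosh, abs_mul, abs_mul]
      exact mul_le_mul_of_nonneg_left ((hB y hy).trans (le_abs_self B)) (abs_nonneg s)
    rw [← ENNReal.ofReal_add (Real.exp_pos _).le (Real.exp_pos _).le,
      ← ENNReal.ofReal_mul (by positivity)]
    refine ENNReal.ofReal_le_ofReal ?_
    simp only [Pi.add_apply, Pi.sub_apply, Pi.smul_apply, smul_eq_mul, Real.exp_add, sub_eq_add_neg]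
    rw [Real.cosh_eq] at h2
    nlinarith [mul_le_mul_of_nonneg_right h2 (Real.exp_pos (g y)).le]
  have h2 : expIntegral ρ K g + expIntegral ρ K (g - s • h)
      < expIntegral ρ K g + ENNReal.ofReal (Real.exp (s * δ)) * expIntegral ρ K g := by
    calc _ ≤ _ := (add_le_add_left (hmin s hs0 hs1) _).trans h1
      _ < ENNReal.ofReal (1 + Real.exp (s * δ)) * expIntegral ρ K g := by
        refine ENNReal.mul_lt_mul_left hpos hfin ?_
        exact (ENNReal.ofReal_lt_ofReal_iff (by positivity)).2 hs
      _ = _ := by rw [ENNReal.ofReal_add zero_le_one (Real.exp_pos _).le]; simp [add_mul]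
  have h3 := lt_of_add_lt_add_left h2
  calc _ < ENNReal.ofReal (Real.exp (-(s * δ)))
        * (ENNReal.ofReal (Real.exp (s * δ)) * expIntegral ρ K g) :=
        ENNReal.mul_lt_mul_right (by simp [Real.exp_pos]) ENNReal.ofReal_ne_top h3
    _ = _ := by
      rw [← mul_assoc, ← ENNReal.ofReal_mul (Real.exp_pos _).le, ← Real.exp_add]; simp

lemma expIntegral_eq_ofReal {ρ : Measure S} [IsFiniteMeasure ρ] {K : Set S}
    (hK : MeasurableSet K) {u : S → ℝ} (hu : Measurable u) {B : ℝ} (hB : ∀ y ∈ K, u y ≤ B) :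
    expIntegral ρ K u = ENNReal.ofReal (∫ y in K, Real.exp (u y) ∂ρ) := by
  rw [expIntegral, ofReal_integral_eq_lintegral_ofReal]
  · refine Integrable.of_bound (C := Real.exp B) (by fun_prop) ?_
    filter_upwards [ae_restrict_mem hK] with y hy
    rw [Real.norm_of_nonneg (Real.exp_pos _).le]
    exact Real.exp_le_exp.2 (hB y hy)
  · exact Eventually.of_forall fun _ => (Real.exp_pos _).le

lemma abs_sum_mul_le {ι : Type*} [Fintype ι] {f : ι → ℝ} {l : ι → ℝ} {B R : ℝ}
    (hf : ∀ j, |f j| ≤ B) (hl : ∀ j, 0 ≤ l j) (hR : ∀ j, l j ≤ R) :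
    |∑ j, l j * f j| ≤ Fintype.card ι * (R * B) := by
  refine (Finset.abs_sum_le_sum_abs _ _).trans ?_
  calc _ ≤ ∑ _j : ι, R * B := by
        refine Finset.sum_le_sum fun j _ => ?_
        rw [abs_mul, abs_of_nonneg (hl j)]
        exact mul_le_mul (hR j) (hf j) (abs_nonneg _) ((hl j).trans (hR j))
    _ = _ := by simp

lemma measurable_sum_smul {ι : Type*} [Fintype ι] {f : ι → S → ℝ} (hf : ∀ j, Measurable (f j))
    (l : ι → ℝ) : Measurable (∑ j, l j • f j) := by
  have := Finset.measurable_sum Finset.univ fun j _ => (hf j).const_smul (l j)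
  convert this
  simp

lemma exists_isMinOn_expIntegral {ρ : Measure S} [IsFiniteMeasure ρ] {K : Set S}
    (hK : MeasurableSet K) {ι : Type*} [Fintype ι] {f : ι → S → ℝ} (hf : ∀ j, Measurable (f j))
    {B : ℝ} (hB : ∀ j, ∀ y ∈ K, |f j y| ≤ B) {c C : ℝ} (hc : 0 < c)
    (hcoer : ∀ l : ι → ℝ, (∀ j, 0 ≤ l j) →
      ENNReal.ofReal (Real.exp (c * ∑ j, l j - C)) ≤ expIntegral ρ K (∑ j, l j • f j)) :
    ∃ l : ι → ℝ, (∀ j, 0 ≤ l j) ∧ ∀ l' : ι → ℝ, (∀ j, 0 ≤ l' j) →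
      expIntegral ρ K (∑ j, l j • f j) ≤ expIntegral ρ K (∑ j, l' j • f j) := by
  have hB' : ∀ j, ∀ y ∈ K, |f j y| ≤ |B| := fun j y hy => (hB j y hy).trans (le_abs_self B)
  have hmeas : ∀ l : ι → ℝ, Measurable (∑ j, l j • f j) := measurable_sum_smul hf
  have happ : ∀ (l : ι → ℝ) y, (∑ j, l j • f j) y = ∑ j, l j * f j y := by
    intro l y; simp [Finset.sum_apply]
  -- Outside the box `[0, R]^ι` the coercive lower bound already exceeds the value at `l = 0`, so
  -- minimizing over the compact box is enough.
  obtain ⟨R, hR0, hR⟩ : ∃ R : ℝ, 0 ≤ R ∧ expIntegral ρ K 0 ≤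
      ENNReal.ofReal (Real.exp (c * R - C)) := by
    have hK1 : expIntegral ρ K 0 = ENNReal.ofReal (ρ.real K) := by
      simp [expIntegral, Measure.real]
    refine ⟨max 0 ((C + ρ.real K) / c), le_max_left _ _, ?_⟩
    rw [hK1]
    refine ENNReal.ofReal_le_ofReal ?_
    have h1 : C + ρ.real K ≤ c * max 0 ((C + ρ.real K) / c) := by
      calc _ = c * ((C + ρ.real K) / c) := by field_simp
        _ ≤ _ := by gcongr; exact le_max_right _ _
    have := Real.add_one_le_exp (c * max 0 ((C + ρ.real K) / c) - C)
    linarith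
  have hcont : ContinuousOn (fun l : ι → ℝ => ∫ y in K, Real.exp ((∑ j, l j • f j) y) ∂ρ)
      (Set.Icc 0 (fun _ => R)) := by
    refine MeasureTheory.continuousOn_of_dominated
      (bound := fun _ => Real.exp (Fintype.card ι * (R * |B|))) ?_ ?_ ?_ ?_
    · intro l _
      exact (Real.measurable_exp.comp (hmeas l)).aestronglyMeasurable
    · intro l hl
      filter_upwards [ae_restrict_mem hK] with y hy
      rw [Real.norm_of_nonneg (Real.exp_pos _).le, happ]
      exact Real.exp_le_exp.2 ((le_abs_self _).trans
        (abs_sum_mul_le (fun j => hB' j y hy) hl.1 hl.2))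
    · exact integrable_const _
    · refine Eventually.of_forall fun y => ?_
      simp only [happ]
      fun_prop
  obtain ⟨l, hl, hlmin⟩ := (isCompact_Icc (a := (0 : ι → ℝ)) (b := fun _ => R)).exists_isMinOn
    ⟨0, le_rfl, fun _ => hR0⟩ hcont
  have heq : ∀ l ∈ Set.Icc (0 : ι → ℝ) (fun _ => R), expIntegral ρ K (∑ j, l j • f j)
      = ENNReal.ofReal (∫ y in K, Real.exp ((∑ j, l j • f j) y) ∂ρ) := by
    intro l hl
    refine expIntegral_eq_ofReal hK (hmeas l) (B := Fintype.card ι * (R * |B|)) fun y hy => ?_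
    rw [happ]
    exact (le_abs_self _).trans
        (abs_sum_mul_le (fun j => hB' j y hy) hl.1 hl.2)
  have hmin : ∀ l' ∈ Set.Icc (0 : ι → ℝ) (fun _ => R),
      expIntegral ρ K (∑ j, l j • f j) ≤ expIntegral ρ K (∑ j, l' j • f j) := by
    intro l' hl'
    rw [heq l hl, heq l' hl']
    exact ENNReal.ofReal_le_ofReal (hlmin hl')
  refine ⟨l, hl.1, fun l' hl' => ?_⟩
  by_cases hbox : ∀ j, l' j ≤ R
  · exact hmin l' ⟨hl', hbox⟩
  · push Not at hbox
    obtain ⟨j, hj⟩ := hbox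
    have h0 := hmin 0 ⟨le_rfl, fun _ => hR0⟩
    simp only [Pi.zero_apply, zero_smul, Finset.sum_const_zero] at h0
    refine (h0.trans hR).trans (le_trans ?_ (hcoer l' hl'))
    gcongr
    exact hj.le.trans (Finset.single_le_sum (fun j _ => hl' j) (Finset.mem_univ j))

/-- Lower bound of Cramér type for finitely many functions that are bounded on `K`. -/
lemma eventually_le_measure_sums {P : Measure Ω} [IsProbabilityMeasure P] {ξ : ℕ → Ω → S}
    (hm : ∀ i, Measurable (ξ i)) (hi : iIndepFun ξ P) (hid : ∀ i, IdentDistrib (ξ i) (ξ 0) P P)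
    {K : Set S} (hK : MeasurableSet K) {ι : Type*} [Fintype ι] {f : ι → S → ℝ}
    (hf : ∀ j, Measurable (f j)) {B : ℝ} (hB : ∀ j, ∀ y ∈ K, |f j y| ≤ B)
    {c C β δ : ℝ} (hc : 0 < c) (hδ : 0 < δ)
    (hcoer : ∀ l : ι → ℝ, (∀ j, 0 ≤ l j) → ENNReal.ofReal (Real.exp (c * ∑ j, l j - C))
      ≤ expIntegral (P.map (ξ 0)) K (∑ j, l j • f j))
    (hβ : ∀ l : ι → ℝ, (∀ j, 0 ≤ l j) →
      ENNReal.ofReal (Real.exp β) < expIntegral (P.map (ξ 0)) K (∑ j, l j • f j)) :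
    ∀ᶠ n : ℕ in atTop, ENNReal.ofReal (Real.exp (n * β)) ≤
      P {ω | (∀ i < n, ξ i ω ∈ K) ∧ ∀ j, -(n * δ) < ∑ i ∈ Finset.range n, f j (ξ i ω)} := by
  classical
  have : IsProbabilityMeasure (P.map (ξ 0)) :=
    Measure.isProbabilityMeasure_map (hm 0).aemeasurable
  obtain ⟨l, hl, hmin⟩ := exists_isMinOn_expIntegral hK hf hB hc hcoer
  set ρ := P.map (ξ 0)
  set g : S → ℝ := ∑ j, l j • f j
  have hg : Measurable g := measurable_sum_smul hf l
  have hgB : ∀ y ∈ K, |g y| ≤ Fintype.card ι * ((∑ j, l j) * |B|) := by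
    intro y hy
    have : g y = ∑ j, l j * f j y := by simp [g, Finset.sum_apply]
    rw [this]
    exact abs_sum_mul_le (fun j => (hB j y hy).trans (le_abs_self B)) hl
      fun j => Finset.single_le_sum (fun j _ => hl j) (Finset.mem_univ j)
  have hfin : expIntegral ρ K g ≠ ⊤ := by
    rw [expIntegral_eq_ofReal hK hg fun y hy => (le_abs_self _).trans (hgB y hy)]
    exact ENNReal.ofReal_ne_top
  -- Shrinking `δ` only strengthens the event and makes room for `β + δ'` below the strict bound at
  -- the minimizer.
  obtain ⟨δ', hδ'0, hδ'δ, hδ'⟩ : ∃ δ' : ℝ, 0 < δ' ∧ δ' ≤ δ ∧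
      ENNReal.ofReal (Real.exp (β + δ')) < expIntegral ρ K g := by
    have h1 : ∀ᶠ d : ℝ in 𝓝 0, ENNReal.ofReal (Real.exp (β + d)) < expIntegral ρ K g := by
      refine (ContinuousAt.tendsto (f := fun d : ℝ => ENNReal.ofReal (Real.exp (β + d)))
        ?_).eventually_lt_const (by simpa using hβ l hl)
      exact (ENNReal.continuous_ofReal.comp (by fun_prop)).continuousAt
    obtain ⟨d, ⟨hd1, hd2⟩, hd0⟩ :=
      (((h1.and (eventually_lt_nhds hδ)).filter_mono nhdsWithin_le_nhds).and
        (self_mem_nhdsWithin : Set.Ioi (0 : ℝ) ∈ 𝓝[>] 0)).exists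
    exact ⟨d, hd0, hd2.le, hd1⟩
  have hpos : expIntegral ρ K g ≠ 0 := (zero_le.trans_lt hδ').ne'
  let h : Option ι → S → ℝ := fun o => o.elim (-g) f
  have key := eventually_le_measure_of_tilt (h := h) (g := g) (j₀ := none) (β := β) (δ := δ')
    hm hi hid hK (by rintro (_ | j); exacts [hg.neg, hf j]) hg rfl hfin hδ' (by
      rintro (_ | j)
      -- Moving in the direction `-g` rescales the weights by `1 - s`, which is admissible because
      -- `s ≤ 1`.
      · refine exists_tilt_lt (B := Fintype.card ι * ((∑ j, l j) * |B|)) hg hg.neg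
          (fun y hy => ?_) hδ'0 hfin hpos fun s hs0 hs1 => ?_
        · rw [Pi.neg_apply, abs_neg]; exact hgB y hy
        · have : g + s • -g = ∑ j, ((1 - s) * l j) • f j := by
            simp only [mul_smul, ← Finset.smul_sum]
            change _ = (1 - s) • g
            module
          rw [this]
          exact hmin _ fun j => mul_nonneg (by linarith) (hl j)
      · refine exists_tilt_lt hg (hf j) (hB j) hδ'0 hfin hpos fun s hs0 hs1 => ?_
        have : g + s • f j = ∑ i, (l i + if i = j then s else 0) • f i := by
          simp only [add_smul, Finset.sum_add_distrib, ite_smul, zero_smul,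
            Finset.sum_ite_eq', Finset.mem_univ, if_true]
          rfl
        rw [this]
        exact hmin _ fun i => add_nonneg (hl i) (by split_ifs <;> linarith))
  filter_upwards [key] with n hn
  refine hn.trans (measure_mono fun ω hω => ⟨hω.1, fun j => lt_of_le_of_lt ?_ (hω.2 (some j))⟩)
  gcongr

end Tilting

/-! ### Convex compact sets and equicontinuous families of functionals. -/

section ConvexCompact

/-- Neighbourhoods of zero are absorbing; the constant depends on `y` and `W` but not on the
functional. -/
lemma exists_abs_le_of_abs_le_nhds
    {E : Type*} [AddCommGroup E] [Module ℝ E] [TopologicalSpace E] [ContinuousSMul ℝ E]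
    {W : Set E} (hW : W ∈ 𝓝 (0 : E)) (y : E) :
    ∃ C : ℝ, 0 ≤ C ∧ ∀ (ν : E →L[ℝ] ℝ) (a : ℝ), (∀ w ∈ W, |ν w| ≤ a) → |ν y| ≤ C * a := by
  have h1 : ∀ᶠ c : ℝ in 𝓝 0, c • y ∈ W := by
    have : Tendsto (fun c : ℝ => c • y) (𝓝 0) (𝓝 0) := by
      have : Continuous fun c : ℝ => c • y := by fun_prop
      simpa using this.tendsto 0
    exact this hW
  obtain ⟨c, hc, hc0⟩ := ((h1.filter_mono nhdsWithin_le_nhds).and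
    (self_mem_nhdsWithin : Set.Ioi (0 : ℝ) ∈ 𝓝[>] 0)).exists
  have hc0' : 0 < c := hc0
  refine ⟨c⁻¹, by positivity, fun ν a h => ?_⟩
  have := h _ hc
  rw [map_smul, smul_eq_mul, abs_mul, abs_of_pos hc0'] at this
  rw [inv_mul_eq_div, le_div_iff₀ hc0']
  linarith

lemma abs_sub_le_of_abs_le_nhds {E : Type*} [AddCommGroup E] [Module ℝ E]
    {W : Set E} {ν : E →ₗ[ℝ] ℝ} {a η : ℝ} (hη : 0 < η)
    (hν : ∀ w ∈ W, |ν w| ≤ a) {y z : E} (hz : η⁻¹ • (z - y) ∈ W) : |ν z - ν y| ≤ η * a := by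
  have := hν _ hz
  rw [map_smul, smul_eq_mul, abs_mul, abs_of_pos (inv_pos.2 hη), map_sub,
    inv_mul_eq_div, div_le_iff₀ hη] at this
  linarith

variable {E : Type*} [AddCommGroup E] [Module ℝ E] [TopologicalSpace E] [IsTopologicalAddGroup E]
  [ContinuousSMul ℝ E]

/-- The hull of two convex sets is their join, a continuous image of `[0,1] × K₁ × K₂`. Convexity of
both is essential: in a general locally convex space the hull of a compact set need not be compact.
-/
lemma exists_convex_isCompact_union_subset {K₁ K₂ : Set E} (hc₁ : Convex ℝ K₁)
    (hK₁ : IsCompact K₁) (hc₂ : Convex ℝ K₂) (hK₂ : IsCompact K₂) :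
    ∃ K : Set E, Convex ℝ K ∧ IsCompact K ∧ K₁ ⊆ K ∧ K₂ ⊆ K := by
  rcases K₁.eq_empty_or_nonempty with rfl | h₁
  · exact ⟨K₂, hc₂, hK₂, Set.empty_subset _, subset_rfl⟩
  rcases K₂.eq_empty_or_nonempty with rfl | h₂
  · exact ⟨K₁, hc₁, hK₁, subset_rfl, Set.empty_subset _⟩
  refine ⟨convexHull ℝ (K₁ ∪ K₂), convex_convexHull _ _, ?_,
    Set.subset_union_left.trans (subset_convexHull _ _),
    Set.subset_union_right.trans (subset_convexHull _ _)⟩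
  rw [hc₁.convexHull_union hc₂ h₁ h₂]
  have : convexJoin ℝ K₁ K₂ = (fun p : ℝ × E × E => (1 - p.1) • p.2.1 + p.1 • p.2.2) ''
      (Set.Icc 0 1 ×ˢ K₁ ×ˢ K₂) := by
    ext z
    simp only [mem_convexJoin, segment_eq_image, Set.mem_image, Set.mem_prod, Prod.exists]
    constructor
    · rintro ⟨a, ha, b, hb, t, ht, rfl⟩
      exact ⟨t, a, b, ⟨ht, ha, hb⟩, rfl⟩
    · rintro ⟨t, a, b, ⟨ht, ha, hb⟩, rfl⟩
      exact ⟨a, ha, b, hb, t, ht, rfl⟩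
  rw [this]
  exact (isCompact_Icc.prod (hK₁.prod hK₂)).image (by fun_prop)

lemma preimage_inv_smul_mem_nhds {W : Set E} (hW : W ∈ 𝓝 (0 : E)) (η : ℝ) (y : E) :
    {z | η⁻¹ • (z - y) ∈ W} ∈ 𝓝 y := by
  have h : Continuous fun z : E => η⁻¹ • (z - y) := by fun_prop
  have := h.tendsto y
  simp only [sub_self, smul_zero] at this
  exact this hW

/-- A linear functional that is bounded on a neighbourhood of zero is continuous. -/
lemma continuous_of_abs_le_nhds {W : Set E} (hW : W ∈ 𝓝 (0 : E)) {ν : E →ₗ[ℝ] ℝ} {a : ℝ}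
    (hν : ∀ w ∈ W, |ν w| ≤ a) : Continuous ν := by
  refine Metric.continuous_iff'.2 fun y ε hε => ?_
  have h0 : 0 ≤ a := (abs_nonneg _).trans (hν 0 (mem_of_mem_nhds hW))
  filter_upwards [preimage_inv_smul_mem_nhds hW (ε / (a + 1)) y] with z hz
  rw [Real.dist_eq]
  refine (abs_sub_le_of_abs_le_nhds (by positivity) hν hz).trans_lt ?_
  rw [div_mul_eq_mul_div, div_lt_iff₀ (by positivity)]
  nlinarith

/-- Banach-Alaoglu along an ultrafilter, with uniform convergence on compact sets. -/
lemma exists_tendsto_of_abs_le_nhds {W : Set E} (hW : W ∈ 𝓝 (0 : E)) (U : Ultrafilter ℕ)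
    (ν : ℕ → E →L[ℝ] ℝ) {a : ℝ} (hν : ∀ n, ∀ w ∈ W, |ν n w| ≤ a) :
    ∃ μ : E →L[ℝ] ℝ, (∀ y, Tendsto (fun n => ν n y) U (𝓝 (μ y))) ∧
      ∀ K : Set E, IsCompact K → ∀ ε > 0, ∀ᶠ n in (U : Filter ℕ), ∀ y ∈ K, μ y ≤ ν n y + ε := by
  choose C hC0 hC using fun y : E => exists_abs_le_of_abs_le_nhds hW y
  have h1 : ∀ y, ∃ r : ℝ, Tendsto (fun n => ν n y) U (𝓝 r) := by
    intro y
    obtain ⟨r, -, hr⟩ := (isCompact_Icc (a := -(C y * a)) (b := C y * a)).ultrafilter_le_nhds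
      (U.map fun n => ν n y) (by
        rw [le_principal_iff]
        refine Ultrafilter.mem_map.2 (Eventually.of_forall fun n => ?_)
        exact abs_le.1 (hC y (ν n) a (hν n)))
    exact ⟨r, hr⟩
  choose φ hφ using h1
  let μ : E →ₗ[ℝ] ℝ := linearMapOfTendsto φ (fun n => (ν n : E →ₗ[ℝ] ℝ)) (l := (U : Filter ℕ))
    (tendsto_pi_nhds.2 fun y => hφ y)
  have hμφ : ∀ y, μ y = φ y := fun y => rfl
  have hμW : ∀ w ∈ W, |μ w| ≤ a := fun w hw =>
    le_of_tendsto (hφ w).abs (Eventually.of_forall fun n => hν n w hw)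
  have ha : 0 ≤ a := (abs_nonneg _).trans (hμW 0 (mem_of_mem_nhds hW))
  refine ⟨⟨μ, continuous_of_abs_le_nhds hW hμW⟩, fun y => hφ y, fun K hK ε hε => ?_⟩
  -- Within one piece `y + ηW` of the finite cover, every functional bounded by `a` on `W` varies by
  -- at most `ηa ≤ ε/3`. Pointwise convergence at the finitely many centres then gives the uniform
  -- bound.
  set η := ε / (3 * (a + 1)) with hη
  have hη0 : 0 < η := by positivity
  have hηa : η * a ≤ ε / 3 := by
    rw [hη, div_mul_eq_mul_div, div_le_div_iff₀ (by positivity) (by positivity)]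
    nlinarith
  obtain ⟨t, -, ht⟩ := hK.elim_nhds_subcover (fun y => {z | η⁻¹ • (z - y) ∈ W})
    fun y _ => preimage_inv_smul_mem_nhds hW η y
  have h2 : ∀ᶠ n in (U : Filter ℕ), ∀ y ∈ t, μ y < ν n y + ε / 3 := by
    rw [Filter.eventually_all_finset]
    intro y _
    filter_upwards [(hφ y).eventually_const_lt (show φ y - ε / 3 < φ y by linarith)] with n hn
    rw [hμφ]; linarith
  filter_upwards [h2] with n hn y hy
  obtain ⟨z, hz, hzy⟩ := Set.mem_iUnion₂.1 (ht hy)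
  have h3 := abs_le.1 (abs_sub_le_of_abs_le_nhds hη0 hμW hzy)
  have h4 := abs_le.1 (abs_sub_le_of_abs_le_nhds (ν := (ν n : E →ₗ[ℝ] ℝ)) hη0 (hν n) hzy)
  have h5 := hn z hz
  simp only [ContinuousLinearMap.coe_coe] at h4
  change μ y ≤ _
  linarith [h3.2, h4.1]

end ConvexCompact

/-! ### Barycenters and Jensen's inequality. -/

section Barycenter

lemma IsCompact.exists_abs_le {X : Type*} [TopologicalSpace X] {K : Set X} (hK : IsCompact K)
    {f : X → ℝ} (hf : Continuous f) : ∃ B, ∀ y ∈ K, |f y| ≤ B :=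
  hK.exists_bound_of_continuousOn hf.continuousOn

lemma integrableOn_of_isCompact {E : Type*} [TopologicalSpace E] [T2Space E]
    [MeasurableSpace E] [BorelSpace E] {ρ : Measure E} [IsFiniteMeasure ρ] {K : Set E}
    (hK : IsCompact K) {f : E → ℝ} (hf : Continuous f) : IntegrableOn f K ρ := by
  obtain ⟨B, hB⟩ := hK.exists_abs_le hf
  refine Integrable.of_bound (C := B) hf.measurable.aestronglyMeasurable ?_
  filter_upwards [ae_restrict_mem hK.measurableSet] with y hy using hB y hy

variable {E : Type*} [AddCommGroup E] [Module ℝ E] [TopologicalSpace E] [T2Space E]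
  [MeasurableSpace E] [BorelSpace E]

/-- By compactness of `K` it suffices to match finitely many functionals at once. Mapping by them
into a finite-dimensional space, the average lies in the closed convex image of `K`. No
vector-valued integral in `E` is needed. -/
lemma exists_barycenter {ρ : Measure E} [IsFiniteMeasure ρ] {K : Set E} (hc : Convex ℝ K)
    (hK : IsCompact K) (h0 : ρ K ≠ 0) :
    ∃ b ∈ K, ∀ ν : E →L[ℝ] ℝ, ν b = ⨍ y in K, ν y ∂ρ := by
  have key := hK.inter_iInter_nonempty (fun ν : E →L[ℝ] ℝ => {b | ν b = ⨍ y in K, ν y ∂ρ})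
    (fun ν => isClosed_eq ν.continuous continuous_const) (by
      intro u
      let T : E →L[ℝ] (u → ℝ) := ContinuousLinearMap.pi fun ν => ν.1
      have hTi : IntegrableOn T K ρ := by
        refine Integrable.of_eval fun i => ?_
        exact integrableOn_of_isCompact hK i.1.continuous
      have hmem := (hc.is_linear_image T.toLinearMap.isLinear).set_average_mem
        (hK.image T.continuous).isClosed h0 (measure_ne_top ρ K)
        ((ae_restrict_mem hK.measurableSet).mono fun y hy => Set.mem_image_of_mem T hy) hTi
      obtain ⟨b, hb, hTb⟩ := hmem
      refine ⟨b, hb, Set.mem_iInter₂.2 fun ν hν => ?_⟩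
      have h1 : T b ⟨ν, hν⟩ = (⨍ y in K, T y ∂ρ) ⟨ν, hν⟩ := congrFun hTb _
      rw [setAverage_eq, Pi.smul_apply, eval_integral] at h1
      · rw [Set.mem_ofPred_eq, setAverage_eq]
        exact h1
      · exact fun i => integrableOn_of_isCompact hK i.1.continuous)
  obtain ⟨b, hb, hb'⟩ := key
  exact ⟨b, hb, fun ν => Set.mem_iInter.1 hb' ν⟩

/-- Jensen's inequality at the barycenter of a convex compact set. -/
lemma exists_exp_le_expIntegral {ρ : Measure E} [IsFiniteMeasure ρ] {K : Set E}
    (hc : Convex ℝ K) (hK : IsCompact K) (h0 : ρ K ≠ 0) :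
    ∃ b ∈ K, ∃ C : ℝ, ∀ ν : E →L[ℝ] ℝ,
      ENNReal.ofReal (Real.exp (ν b - C)) ≤ expIntegral ρ K ν := by
  obtain ⟨b, hb, hbar⟩ := exists_barycenter hc hK h0
  have hpos : 0 < ρ.real K := ENNReal.toReal_pos h0 (measure_ne_top ρ K)
  refine ⟨b, hb, -Real.log (ρ.real K), fun ν => ?_⟩
  obtain ⟨B, hB⟩ := hK.exists_abs_le ν.continuous
  rw [expIntegral_eq_ofReal hK.measurableSet ν.continuous.measurable
    fun y hy => (le_abs_self _).trans (hB y hy)]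
  refine ENNReal.ofReal_le_ofReal ?_
  have h1 := convexOn_exp.map_set_average_le (μ := ρ) (t := K) (f := ν)
    Real.continuous_exp.continuousOn isClosed_univ h0 (measure_ne_top ρ K)
    (Eventually.of_forall fun _ => Set.mem_univ _) (integrableOn_of_isCompact hK ν.continuous)
    (integrableOn_of_isCompact hK (Real.continuous_exp.comp ν.continuous))
  rw [← hbar ν, setAverage_eq, smul_eq_mul, inv_mul_eq_div, le_div_iff₀ hpos] at h1
  rw [sub_neg_eq_add, Real.exp_add, Real.exp_log hpos]
  exact h1

end Barycenter

/-! ### Restricting the dual inequality to a convex compact set. -/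

section Duality

variable {E : Type*} [AddCommGroup E] [Module ℝ E] [TopologicalSpace E] [IsTopologicalAddGroup E]
  [ContinuousSMul ℝ E] [T2Space E] [MeasurableSpace E] [BorelSpace E]

lemma expIntegral_mono_set {S : Type*} [MeasurableSpace S] {ρ : Measure S} {K K' : Set S}
    (h : K ⊆ K') (u : S → ℝ) : expIntegral ρ K u ≤ expIntegral ρ K' u :=
  lintegral_mono_set h

lemma expIntegral_le_ofReal_exp_mul {S : Type*} [MeasurableSpace S] {ρ : Measure S} {K : Set S}
    {u v : S → ℝ} (hv : Measurable v) {a : ℝ} (h : ∀ y ∈ K, u y ≤ v y + a) :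
    expIntegral ρ K u ≤ ENNReal.ofReal (Real.exp a) * expIntegral ρ K v := by
  rw [expIntegral, expIntegral, ← lintegral_const_mul _ (by fun_prop)]
  refine setLIntegral_mono (by fun_prop) fun y hy => ?_
  rw [← ENNReal.ofReal_mul (Real.exp_pos _).le, ← Real.exp_add]
  exact ENNReal.ofReal_le_ofReal (Real.exp_le_exp.2 (by linarith [h y hy]))

lemma exists_measure_inter_ne_zero {E : Type*} [AddCommGroup E] [Module ℝ E] [TopologicalSpace E]
    [T2Space E] [MeasurableSpace E] [BorelSpace E] {ρ : Measure E} [IsProbabilityMeasure ρ]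
    (htight : ∀ ε : ℝ, 0 < ε → ∃ K : Set E, Convex ℝ K ∧ IsCompact K ∧ 1 - ENNReal.ofReal ε ≤ ρ K)
    {A : Set E} (hA : ρ A ≠ 0) : ∃ K : Set E, Convex ℝ K ∧ IsCompact K ∧ ρ (K ∩ A) ≠ 0 := by
  have hA' : 0 < ρ.real A := ENNReal.toReal_pos hA (measure_ne_top _ _)
  obtain ⟨K, hc, hK, hρ⟩ := htight (ρ.real A / 2) (by positivity)
  refine ⟨K, hc, hK, fun h0 => ?_⟩
  have h1 : ρ A ≤ ρ Kᶜ := by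
    calc ρ A ≤ ρ (K ∩ A) + ρ (A \ K) := by
          rw [Set.inter_comm]; exact measure_le_inter_add_sdiff _ _ _
      _ ≤ ρ Kᶜ := by rw [h0, zero_add]; exact measure_mono fun y hy => hy.2
  rw [prob_compl_eq_one_sub hK.measurableSet] at h1
  have h2 : ρ A ≤ ENNReal.ofReal (ρ.real A / 2) := h1.trans (tsub_le_iff_tsub_le.1 hρ)
  have h3 := ENNReal.toReal_mono ENNReal.ofReal_ne_top h2
  rw [ENNReal.toReal_ofReal (by positivity)] at h3
  change ρ.real A ≤ _ at h3
  linarith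

/-- If no functional that is nonnegative on `Q` certifies `-β < ν x - Λ(ν)`, then arbitrarily close
to `x` there is a point where the conjugate of the restricted exponential integral is finite. -/
lemma exists_exp_le_expIntegral_near [LocallyConvexSpace ℝ E] {ρ : Measure E}
    [IsProbabilityMeasure ρ]
    (htight : ∀ ε : ℝ, 0 < ε → ∃ K : Set E, Convex ℝ K ∧ IsCompact K ∧ 1 - ENNReal.ofReal ε ≤ ρ K)
    (Q : Set E) {x : E} {β : ℝ}
    (H : ∀ ν : E →L[ℝ] ℝ, (∀ y ∈ Q, 0 ≤ ν y) →
      ENNReal.ofReal (Real.exp (ν x + β)) < expIntegral ρ Set.univ ν)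
    {W : Set E} (hW : W ∈ 𝓝 x) :
    ∃ x' ∈ W, ∃ K : Set E, Convex ℝ K ∧ IsCompact K ∧ ∃ C : ℝ, ∀ ν : E →L[ℝ] ℝ,
      (∀ y ∈ Q, 0 ≤ ν y) → ENNReal.ofReal (Real.exp (ν x' - C)) ≤ expIntegral ρ K ν := by
  by_contra! hcon
  -- `S` is convex, stable under subtracting elements of `Q`, and contains the barycenter of every
  -- convex compact set of positive mass. If it misses `W`, it can be separated from `x`.
  let S : Set E := {y | ∃ K : Set E, Convex ℝ K ∧ IsCompact K ∧ ∃ C : ℝ, ∀ ν : E →L[ℝ] ℝ,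
      (∀ y ∈ Q, 0 ≤ ν y) → ENNReal.ofReal (Real.exp (ν y - C)) ≤ expIntegral ρ K ν}
  have hWS : ∀ y ∈ W, y ∉ S := by
    rintro y hy ⟨K, hc, hK, C, hC⟩
    obtain ⟨ν, hν, hlt⟩ := hcon y hy K hc hK C
    exact hlt.not_ge (hC ν hν)
  have hSc : Convex ℝ S := by
    rintro y₁ ⟨K₁, hc₁, hK₁, C₁, h₁⟩ y₂ ⟨K₂, hc₂, hK₂, C₂, h₂⟩ a b ha hb hab
    obtain ⟨K, hc, hK, hs₁, hs₂⟩ := exists_convex_isCompact_union_subset hc₁ hK₁ hc₂ hK₂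
    refine ⟨K, hc, hK, max C₁ C₂, fun ν hν => ?_⟩
    have h3 : ν (a • y₁ + b • y₂) = a * ν y₁ + b * ν y₂ := by simp
    rcases le_total (ν y₁) (ν y₂) with h | h
    · refine le_trans ?_ ((h₂ ν hν).trans (expIntegral_mono_set hs₂ _))
      refine ENNReal.ofReal_le_ofReal (Real.exp_le_exp.2 ?_)
      rw [h3]
      have : a * ν y₁ + b * ν y₂ ≤ ν y₂ := by
        calc _ ≤ a * ν y₂ + b * ν y₂ := by gcongr
          _ = ν y₂ := by rw [← add_mul, hab, one_mul]
      linarith [le_max_right C₁ C₂]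
    · refine le_trans ?_ ((h₁ ν hν).trans (expIntegral_mono_set hs₁ _))
      refine ENNReal.ofReal_le_ofReal (Real.exp_le_exp.2 ?_)
      rw [h3]
      have : a * ν y₁ + b * ν y₂ ≤ ν y₁ := by
        calc _ ≤ a * ν y₁ + b * ν y₁ := by gcongr
          _ = ν y₁ := by rw [← add_mul, hab, one_mul]
      linarith [le_max_left C₁ C₂]
  have hSQ : ∀ y ∈ S, ∀ q ∈ Q, ∀ c : ℝ, 0 ≤ c → y - c • q ∈ S := by
    rintro y ⟨K, hc, hK, C, hC⟩ q hq c hc0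
    refine ⟨K, hc, hK, C, fun ν hν => le_trans ?_ (hC ν hν)⟩
    refine ENNReal.ofReal_le_ofReal (Real.exp_le_exp.2 ?_)
    rw [map_sub, map_smul, smul_eq_mul]
    nlinarith [hν q hq, mul_nonneg hc0 (hν q hq)]
  have hbar : ∀ K : Set E, Convex ℝ K → IsCompact K → ρ K ≠ 0 → ∃ b ∈ K, b ∈ S := by
    intro K hc hK h0
    obtain ⟨b, hb, C, hC⟩ := exists_exp_le_expIntegral hc hK h0
    exact ⟨b, hb, K, hc, hK, C, fun ν _ => hC ν⟩
  obtain ⟨N, hNx, hNc, hNW⟩ :=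
    (locallyConvexSpace_iff_exists_convex_subset ℝ E).1 inferInstance x W hW
  obtain ⟨f, u, hfN, hfS⟩ := geometric_hahn_banach_open hNc.interior isOpen_interior hSc
    (Set.disjoint_left.2 fun y hy => hWS y (hNW (interior_subset hy)))
  have hfx : f x < u := hfN x (mem_interior_iff_mem_nhds.2 hNx)
  obtain ⟨y₀, hy₀⟩ : S.Nonempty := by
    obtain ⟨K, hc, hK, h0⟩ := exists_measure_inter_ne_zero htight (A := Set.univ) (by simp)
    rw [Set.inter_univ] at h0
    obtain ⟨b, -, hb⟩ := hbar K hc hK h0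
    exact ⟨b, hb⟩
  have hpos : ∀ q ∈ Q, 0 ≤ (-f) q := by
    intro q hq
    by_contra! hneg
    have hq0 : 0 < f q := by simpa using hneg
    have h1 := hfS _ (hSQ y₀ hy₀ q hq ((|f y₀ - u| + 1) / f q) (by positivity))
    rw [map_sub, map_smul, smul_eq_mul, div_mul_cancel₀ _ hq0.ne'] at h1
    linarith [le_abs_self (f y₀ - u)]
  -- If `f ≤ r < u` had positive probability, the barycenter of a convex compact part of that
  -- half-space would lie in `S`, where `f ≥ u`. So `f > r` almost surely, and a large multiple of
  -- `-f` violates `H`.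
  obtain ⟨r, hr1, hr2⟩ := exists_between hfx
  have hnull : ρ {y | f y ≤ r} = 0 := by
    by_contra h0
    obtain ⟨K, hc, hK, h1⟩ := exists_measure_inter_ne_zero htight h0
    have hcl : IsClosed {y | f y ≤ r} := isClosed_le f.continuous continuous_const
    obtain ⟨b, hb, hbS⟩ := hbar (K ∩ {y | f y ≤ r})
      (hc.inter (convex_halfSpace_le f.toLinearMap.isLinear r)) (hK.inter_right hcl) h1
    have h2 : f b ≤ r := hb.2
    linarith [hfS b hbS]
  -- Chosen so that `-s r ≤ -s f(x) + β`.
  set s := max 0 (-β / (r - f x))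
  have hs0 : 0 ≤ s := le_max_left _ _
  have hs1 : -β ≤ s * (r - f x) := by
    rw [← div_le_iff₀ (by linarith)]; exact le_max_right _ _
  have h1 := H (s • -f) fun q hq => by
    have := mul_nonneg hs0 (hpos q hq)
    simpa using this
  refine h1.not_ge ?_
  calc expIntegral ρ Set.univ (s • -f)
      ≤ ∫⁻ _ : E, ENNReal.ofReal (Real.exp (-(s * r))) ∂ρ := by
        rw [expIntegral, Measure.restrict_univ]
        refine lintegral_mono_ae ?_
        have : ∀ᵐ y ∂ρ, ¬ f y ≤ r := by rw [ae_iff]; simpa using hnull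
        filter_upwards [this] with y hy
        refine ENNReal.ofReal_le_ofReal (Real.exp_le_exp.2 ?_)
        have := mul_le_mul_of_nonneg_left (not_le.1 hy).le hs0
        simpa using this
    _ = ENNReal.ofReal (Real.exp (-(s * r))) := by simp
    _ ≤ _ := by
        refine ENNReal.ofReal_le_ofReal (Real.exp_le_exp.2 ?_)
        simp only [smul_neg, _root_.neg_apply, _root_.smul_apply,
          smul_eq_mul]
        linarith

lemma exists_monotone_convex_isCompact {ρ : Measure E} [IsProbabilityMeasure ρ]
    (htight : ∀ ε : ℝ, 0 < ε → ∃ K : Set E, Convex ℝ K ∧ IsCompact K ∧ 1 - ENNReal.ofReal ε ≤ ρ K)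
    {K₀ : Set E} (hc₀ : Convex ℝ K₀) (hK₀ : IsCompact K₀) :
    ∃ K : ℕ → Set E, Monotone K ∧ (∀ n, Convex ℝ (K n)) ∧ (∀ n, IsCompact (K n)) ∧
      (∀ n, K₀ ⊆ K n) ∧ ∀ᵐ y ∂ρ, y ∈ ⋃ n, K n := by
  choose T hTc hT hTρ using fun n : ℕ => htight (1 / ((n : ℝ) + 1)) (by positivity)
  choose J hJc hJ hJ₁ hJ₂ using fun (A B : {K : Set E // Convex ℝ K ∧ IsCompact K}) =>
    exists_convex_isCompact_union_subset A.2.1 A.2.2 B.2.1 B.2.2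
  let K : ℕ → {K : Set E // Convex ℝ K ∧ IsCompact K} := fun n =>
    Nat.rec ⟨K₀, hc₀, hK₀⟩ (fun n A =>
      ⟨J A ⟨T n, hTc n, hT n⟩, hJc _ _, hJ _ _⟩) n
  have hmono : Monotone fun n => (K n).1 := monotone_nat_of_le_succ fun n => hJ₁ (K n) _
  have hTK : ∀ n, T n ⊆ (K (n + 1)).1 := fun n => hJ₂ (K n) ⟨T n, hTc n, hT n⟩
  refine ⟨fun n => (K n).1, hmono, fun n => (K n).2.1, fun n => (K n).2.2,
    fun n => hmono (Nat.zero_le n), ?_⟩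
  rw [ae_iff]
  refine le_antisymm (ge_of_tendsto' (f := fun n : ℕ => ENNReal.ofReal (1 / ((n : ℝ) + 1)))
    (x := atTop) ?_ fun n => ?_) zero_le
  · rw [← ENNReal.ofReal_zero]
    exact ENNReal.tendsto_ofReal tendsto_one_div_add_atTop_nhds_zero_nat
  · calc _ ≤ ρ (T n)ᶜ := measure_mono (Set.compl_subset_compl.2
          ((hTK n).trans (Set.subset_iUnion (fun n => (K n).1) (n + 1))))
      _ ≤ _ := by
        rw [prob_compl_eq_one_sub (hT n).measurableSet]
        exact tsub_le_iff_tsub_le.1 (hTρ n)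

lemma expIntegral_univ_le_of_forall {E : Type*} [MeasurableSpace E] {ρ : Measure E}
    {K : ℕ → Set E} (hmono : Monotone K)
    (hm : ∀ n, MeasurableSet (K n)) (hae : ∀ᵐ y ∂ρ, y ∈ ⋃ n, K n) {u : E → ℝ} (hu : Measurable u)
    {c : ℝ≥0∞} (h : ∀ n, expIntegral ρ (K n) u ≤ c) : expIntegral ρ Set.univ u ≤ c := by
  have h1 : expIntegral ρ Set.univ u
      = ⨆ n, ∫⁻ y, (K n).indicator (fun y => ENNReal.ofReal (Real.exp (u y))) y ∂ρ := by
    rw [← lintegral_iSup (fun n => Measurable.indicator (by fun_prop) (hm n))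
      (fun m n hmn y => Set.indicator_le_indicator_of_subset (hmono hmn) (fun _ => zero_le) y),
      expIntegral, Measure.restrict_univ]
    refine lintegral_congr_ae ?_
    filter_upwards [hae] with y hy
    obtain ⟨n, hn⟩ := Set.mem_iUnion.1 hy
    refine le_antisymm ?_ (iSup_le fun m => Set.indicator_le_self _ _ _)
    refine le_iSup_of_le n ?_
    rw [Set.indicator_of_mem hn]
  rw [h1]
  refine iSup_le fun n => ?_
  rw [lintegral_indicator (hm n)]
  exact h n

/-- Restriction to a convex compact set: the strict bound `ν x + β < Λ(ν)` on all functionals that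
are nonnegative on `Q` passes, up to a linear term, to the exponential integral over some
convex compact set. -/
lemma exists_convex_isCompact_lt_expIntegral [LocallyConvexSpace ℝ E] {ρ : Measure E}
    [IsProbabilityMeasure ρ]
    (htight : ∀ ε : ℝ, 0 < ε → ∃ K : Set E, Convex ℝ K ∧ IsCompact K ∧ 1 - ENNReal.ofReal ε ≤ ρ K)
    (Q : Set E) {x : E} {β : ℝ}
    (H : ∀ ν : E →L[ℝ] ℝ, (∀ y ∈ Q, 0 ≤ ν y) →
      ENNReal.ofReal (Real.exp (ν x + β)) < expIntegral ρ Set.univ ν)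
    {W : Set E} (hW : W ∈ 𝓝 (0 : E)) :
    ∃ K : Set E, Convex ℝ K ∧ IsCompact K ∧ ∃ C : ℝ, ∀ (ν : E →L[ℝ] ℝ) (t : ℝ),
      (∀ y ∈ Q, 0 ≤ ν y) → (∀ w ∈ W, |ν w| ≤ t / 2) →
      ENNReal.ofReal (Real.exp (ν x - t / 2 - C)) ≤ expIntegral ρ K ν ∧
      ENNReal.ofReal (Real.exp (ν x - t + β)) < expIntegral ρ K ν := by
  have hW' : {y | y - x ∈ W} ∈ 𝓝 x := by
    simpa using preimage_inv_smul_mem_nhds hW 1 x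
  obtain ⟨x', hx', K₀, hc₀, hK₀, C, hC⟩ := exists_exp_le_expIntegral_near htight Q H hW'
  obtain ⟨K, hmono, hKc, hK, hK₀K, hae⟩ := exists_monotone_convex_isCompact htight hc₀ hK₀
  have hlow : ∀ n (ν : E →L[ℝ] ℝ) (t : ℝ), (∀ y ∈ Q, 0 ≤ ν y) → (∀ w ∈ W, |ν w| ≤ t / 2) →
      ENNReal.ofReal (Real.exp (ν x - t / 2 - C)) ≤ expIntegral ρ (K n) ν := by
    intro n ν t hν ht
    refine le_trans ?_ ((hC ν hν).trans (expIntegral_mono_set (hK₀K n) _))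
    refine ENNReal.ofReal_le_ofReal (Real.exp_le_exp.2 ?_)
    have h1 := (abs_le.1 (ht _ hx')).1
    rw [map_sub] at h1
    linarith
  suffices h : ∃ n, ∀ (ν : E →L[ℝ] ℝ) (t : ℝ), (∀ y ∈ Q, 0 ≤ ν y) → (∀ w ∈ W, |ν w| ≤ t / 2) →
      ENNReal.ofReal (Real.exp (ν x - t + β)) < expIntegral ρ (K n) ν by
    obtain ⟨n, hn⟩ := h
    exact ⟨K n, hKc n, hK n, C, fun ν t hν ht => ⟨hlow n ν t hν ht, hn ν t hν ht⟩⟩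
  -- If no `K n` works, the coercive bound and the failed one together bound `t n`. The offending
  -- functionals are thus uniformly bounded on `W` and have an ultrafilter limit `μ`, which
  -- contradicts `H`.
  by_contra! hcon
  choose ν t hν ht hup using hcon
  have htR : ∀ n, t n / 2 ≤ C + β := by
    intro n
    have h1 := (hlow n (ν n) (t n) (hν n) (ht n)).trans (hup n)
    rw [ENNReal.ofReal_le_ofReal_iff (Real.exp_pos _).le, Real.exp_le_exp] at h1
    linarith
  have ht0 : ∀ n, 0 ≤ t n := by
    intro n
    have := (abs_nonneg _).trans (ht n 0 (mem_of_mem_nhds hW))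
    linarith
  obtain ⟨μ, hμ, hunif⟩ := exists_tendsto_of_abs_le_nhds hW (hyperfilter ℕ) ν
    fun n w hw => (ht n w hw).trans (htR n)
  refine (H μ fun y hy => ge_of_tendsto (hμ y) (Eventually.of_forall fun n => hν n y hy)).not_ge ?_
  -- Fix `K m` and compare with `ν n` for `n ≥ m`. One `ε` pays for the uniform comparison on `K m`,
  -- the other for replacing `ν n x` by `μ x`.
  refine expIntegral_univ_le_of_forall hmono (fun n => (hK n).measurableSet) hae
    μ.continuous.measurable fun m => ?_
  have hlim : Tendsto (fun ε : ℝ => ENNReal.ofReal (Real.exp (μ x + β + 2 * ε))) (𝓝[>] 0)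
      (𝓝 (ENNReal.ofReal (Real.exp (μ x + β)))) := by
    have : Continuous fun ε : ℝ => ENNReal.ofReal (Real.exp (μ x + β + 2 * ε)) :=
      ENNReal.continuous_ofReal.comp (by fun_prop)
    have := (this.tendsto 0).mono_left (nhdsWithin_le_nhds (s := Set.Ioi 0))
    simpa using this
  refine ge_of_tendsto hlim ?_
  filter_upwards [self_mem_nhdsWithin] with ε hε
  obtain ⟨n, ⟨hn1, hn2⟩, hn3⟩ := (((hunif (K m) (hK m) ε hε).and
    ((hμ x).eventually_lt_const (show μ x < μ x + ε by simpa using hε))).and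
    (Nat.hyperfilter_le_atTop (eventually_ge_atTop m))).exists
  calc expIntegral ρ (K m) μ
      ≤ ENNReal.ofReal (Real.exp ε) * expIntegral ρ (K m) (ν n) :=
        expIntegral_le_ofReal_exp_mul (ν n).continuous.measurable hn1
    _ ≤ ENNReal.ofReal (Real.exp ε) * ENNReal.ofReal (Real.exp (ν n x - t n + β)) := by
        gcongr
        exact (expIntegral_mono_set (hmono hn3) _).trans (hup n)
    _ ≤ _ := by
        rw [← ENNReal.ofReal_mul (Real.exp_pos _).le, ← Real.exp_add]
        refine ENNReal.ofReal_le_ofReal (Real.exp_le_exp.2 ?_)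
        linarith [ht0 n]

end Duality

/-! ### The lower bound on convex open upsets. -/

section LowerBound

lemma map_sampleMean {E Ω : Type*} [AddCommGroup E] [Module ℝ E] [TopologicalSpace E]
    (ν : E →L[ℝ] ℝ) (ξ : ℕ → Ω → E) (n : ℕ) (ω : Ω) :
    ν (sampleMean ξ n ω) = (n : ℝ)⁻¹ * ∑ i ∈ Finset.range n, ν (ξ i ω) := by
  simp [sampleMean]

lemma sampleMean_mem {E Ω : Type*} [AddCommGroup E] [Module ℝ E] {K : Set E} (hK : Convex ℝ K)
    {ξ : ℕ → Ω → E} {n : ℕ} (hn : n ≠ 0) {ω : Ω} (h : ∀ i < n, ξ i ω ∈ K) :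
    sampleMean ξ n ω ∈ K := by
  rw [sampleMean, Finset.smul_sum]
  refine hK.sum_mem (fun _ _ => by positivity) ?_ fun i hi => h i (Finset.mem_range.1 hi)
  simp [hn]

variable {E : Type*} [AddCommGroup E] [Module ℝ E] [TopologicalSpace E] [IsTopologicalAddGroup E]
  [ContinuousSMul ℝ E] [Preorder E]

/-- Separation of a point from a convex open upper set by a normalized positive functional. -/
lemma exists_separating_positive (Epos : ProperCone ℝ E)
    (hle : ∀ x y : E, x ≤ y ↔ y - x ∈ Epos) {O : Set E} (hO : IsOpen O) (hOu : IsUpperSet O)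
    (hOc : Convex ℝ O) {x p : E} (hx : x ∈ O) (hp : p ∉ O) :
    ∃ μ : E →L[ℝ] ℝ, (∀ y ∈ Epos, 0 ≤ μ y) ∧ μ x - μ p = 2 ∧
      ∀ w, x + (4 : ℝ) • w ∈ O → x - (4 : ℝ) • w ∈ O → |μ w| ≤ 1 / 2 := by
  obtain ⟨f, hf⟩ := geometric_hahn_banach_open_point hOc hO hp
  have hd : 0 < f p - f x := sub_pos.2 (hf x hx)
  have hpos : ∀ q ∈ Epos, f q ≤ 0 := by
    intro q hq
    by_contra! hneg
    set c := (f p - f x) / f q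
    have hc : 0 ≤ c := by positivity
    have h1 : x + c • q ∈ O := by
      refine hOu ((hle x _).2 ?_) hx
      rw [add_sub_cancel_left]
      exact Epos.smul_mem hq hc
    have h2 := hf _ h1
    rw [map_add, map_smul, smul_eq_mul, div_mul_cancel₀ _ hneg.ne'] at h2
    linarith
  -- The factor normalizes the gap to `2`. As `f < f p` at both `x + 4w` and `x - 4w`, `|f w|` is at
  -- most a quarter of the original gap, which gives `1/2`.
  refine ⟨(-(2 / (f p - f x))) • f, fun y hy => ?_, ?_, fun w h1 h2 => ?_⟩
  · have : 0 ≤ (2 / (f p - f x)) * -f y := mul_nonneg (by positivity) (by linarith [hpos y hy])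
    simpa using this
  · simp only [_root_.smul_apply, smul_eq_mul]
    field_simp
    ring
  · have h3 := hf _ h1
    have h4 := hf _ h2
    rw [map_add, map_smul, smul_eq_mul] at h3
    rw [map_sub, map_smul, smul_eq_mul] at h4
    rw [_root_.smul_apply, smul_eq_mul, abs_mul, abs_neg, abs_of_pos (by positivity),
      div_mul_eq_mul_div, div_le_iff₀ hd]
    have : |f w| ≤ (f p - f x) / 4 := abs_le.2 ⟨by linarith, by linarith⟩
    linarith

variable [LocallyConvexSpace ℝ E] [T2Space E] [MeasurableSpace E] [BorelSpace E]
  {Ω : Type*} [MeasurableSpace Ω]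

/-- The lower bound in Cramér's theorem for convex open upper sets. -/
lemma eventually_le_measure_sampleMean (Epos : ProperCone ℝ E)
    (hle : ∀ x y : E, x ≤ y ↔ y - x ∈ Epos) {P : Measure Ω} [IsProbabilityMeasure P]
    {ξ : ℕ → Ω → E} (hm : ∀ i, Measurable (ξ i)) (hi : iIndepFun ξ P)
    (hid : ∀ i, IdentDistrib (ξ i) (ξ 0) P P) (htight : IsConvexTight P (ξ 0))
    {O : Set E} (hO : IsOpen O) (hOu : IsUpperSet O) (hOc : Convex ℝ O) {x : E} (hx : x ∈ O)
    {β : ℝ} (H : ∀ ν : E →L[ℝ] ℝ, (∀ y ∈ Epos, 0 ≤ ν y) →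
      ENNReal.ofReal (Real.exp (ν x + β)) < expIntegral (P.map (ξ 0)) Set.univ ν) :
    ∀ᶠ n : ℕ in atTop, ENNReal.ofReal (Real.exp (n * β)) ≤ P (sampleMean ξ n ⁻¹' O) := by
  have : IsProbabilityMeasure (P.map (ξ 0)) :=
    Measure.isProbabilityMeasure_map (hm 0).aemeasurable
  have htight' : ∀ ε : ℝ, 0 < ε → ∃ K : Set E, Convex ℝ K ∧ IsCompact K ∧
      1 - ENNReal.ofReal ε ≤ P.map (ξ 0) K := by
    intro ε hε
    obtain ⟨K, hc, hK, hP⟩ := htight ε hε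
    exact ⟨K, hc, hK, by rwa [Measure.map_apply (hm 0) hK.measurableSet]⟩
  have hW : {w : E | x + (4 : ℝ) • w ∈ O} ∩ {w | x - (4 : ℝ) • w ∈ O} ∈ 𝓝 (0 : E) := by
    refine IsOpen.mem_nhds ((hO.preimage (by fun_prop)).inter (hO.preimage (by fun_prop))) ?_
    simp [hx]
  obtain ⟨K, hKc, hK, C, hKC⟩ :=
    exists_convex_isCompact_lt_expIntegral htight' (Epos : Set E) H hW
  choose μ hμpos hμ2 hμW using fun p : {p : E // p ∉ O} =>
    exists_separating_positive Epos hle hO hOu hOc hx p.2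
  -- Each `p` outside `O` satisfies `μ p = μ x - 2`, hence lies in its own open half-space at level
  -- `μ x - 3/2`. Finitely many of these cover the compact set `K \ O`.
  obtain ⟨T, hT⟩ := (hK.diff hO).elim_finite_subcover
    (fun p : {p : E // p ∉ O} => {y | μ p y < μ p x - 3 / 2})
    (fun p => isOpen_lt (μ p).continuous continuous_const)
    (fun p hp => Set.mem_iUnion.2 ⟨⟨p, hp.2⟩, by
      have := hμ2 ⟨p, hp.2⟩
      simp only [Set.mem_ofPred_eq] at this ⊢
      linarith⟩)
  -- The shift `1` lies strictly between the `1/2` lost to `|ν w| ≤ t/2` and the level `3/2`. With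
  -- `ν = ∑ l_j μ_j` and `t = ∑ l_j`, the integral of `exp(∑ l_j f_j)` is that of `exp ν` times
  -- `exp(t - ν x)`, so coercivity holds with `c = 1/2`. The choice `δ = 1/2` makes the good event
  -- say `μ_j(X_n) > μ_j x - 3/2`.
  let f : T → E → ℝ := fun j y => μ j y - μ j x + 1
  have hf : ∀ j, Continuous (f j) := fun j => by fun_prop
  obtain ⟨B, hB⟩ : ∃ B, ∀ j, ∀ y ∈ K, |f j y| ≤ B := by
    choose B hB using fun j => hK.exists_abs_le (hf j)
    exact ⟨∑ j, |B j|, fun j y hy => (hB j y hy).trans ((le_abs_self _).trans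
      (Finset.single_le_sum (fun j _ => abs_nonneg (B j)) (Finset.mem_univ j)))⟩
  have hkey : ∀ l : T → ℝ, (∀ j, 0 ≤ l j) →
      expIntegral (P.map (ξ 0)) K (∑ j, l j • μ j : E →L[ℝ] ℝ) ≤
        ENNReal.ofReal (Real.exp ((∑ j, l j • μ j : E →L[ℝ] ℝ) x - ∑ j, l j)) *
          expIntegral (P.map (ξ 0)) K (∑ j, l j • f j) := by
    intro l _
    refine expIntegral_le_ofReal_exp_mul (measurable_sum_smul (fun j => (hf j).measurable) l)
      fun y _ => le_of_eq ?_
    simp only [f, _root_.sum_apply, _root_.smul_apply, smul_eq_mul, Finset.sum_apply,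
      Pi.smul_apply, mul_add, mul_sub, Finset.sum_add_distrib, Finset.sum_sub_distrib, mul_one]
    ring
  have hν : ∀ l : T → ℝ, (∀ j, 0 ≤ l j) →
      (∀ y ∈ (Epos : Set E), 0 ≤ (∑ j, l j • μ j : E →L[ℝ] ℝ) y) ∧
      ∀ w ∈ {w : E | x + (4 : ℝ) • w ∈ O} ∩ {w | x - (4 : ℝ) • w ∈ O},
        |(∑ j, l j • μ j : E →L[ℝ] ℝ) w| ≤ (∑ j, l j) / 2 := by
    intro l hl
    refine ⟨fun y hy => ?_, fun w hw => ?_⟩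
    · simp only [_root_.sum_apply, _root_.smul_apply, smul_eq_mul]
      exact Finset.sum_nonneg fun j _ => mul_nonneg (hl j) (hμpos j y hy)
    · simp only [_root_.sum_apply, _root_.smul_apply, smul_eq_mul]
      refine (Finset.abs_sum_le_sum_abs _ _).trans ?_
      rw [Finset.sum_div]
      refine Finset.sum_le_sum fun j _ => ?_
      rw [abs_mul, abs_of_nonneg (hl j)]
      have := mul_le_mul_of_nonneg_left (hμW j w hw.1 hw.2) (hl j)
      linarith
  have hcancel : ∀ (a b : ℝ), ENNReal.ofReal (Real.exp (a + b))
      = ENNReal.ofReal (Real.exp a) * ENNReal.ofReal (Real.exp b) := fun a b => by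
    rw [Real.exp_add, ENNReal.ofReal_mul (Real.exp_pos _).le]
  have key := eventually_le_measure_sums hm hi hid hK.measurableSet
    (fun j => (hf j).measurable) hB (c := 1 / 2) (C := C) (β := β) (δ := 1 / 2)
    (by norm_num) (by norm_num) (fun l hl => by
      obtain ⟨h1, h2⟩ := hν l hl
      have h3 := (hKC _ _ h1 h2).1.trans (hkey l hl)
      rw [show ∀ a t : ℝ, a - t / 2 - C = (a - t) + (1 / 2 * t - C) by intros; ring,
        hcancel] at h3
      exact (ENNReal.mul_le_mul_iff_right (by simp [Real.exp_pos]) ENNReal.ofReal_ne_top).1 h3)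
    (fun l hl => by
      obtain ⟨h1, h2⟩ := hν l hl
      have h3 := (hKC _ _ h1 h2).2.trans_le (hkey l hl)
      rw [hcancel] at h3
      exact (ENNReal.mul_lt_mul_iff_right (by simp [Real.exp_pos]) ENNReal.ofReal_ne_top).1 h3)
  filter_upwards [key, eventually_ne_atTop 0] with n hn hn0
  refine hn.trans (measure_mono fun ω ⟨hωK, hω⟩ => ?_)
  by_contra hcon
  obtain ⟨p, hpT, hp⟩ := Set.mem_iUnion₂.1 (hT ⟨sampleMean_mem hKc hn0 hωK, hcon⟩)
  have h1 := hω ⟨p, hpT⟩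
  have hnpos : (0 : ℝ) < n := by positivity
  have h2 : μ p (sampleMean ξ n ω) < μ p x - 3 / 2 := hp
  rw [map_sampleMean, inv_mul_eq_div, div_lt_iff₀ hnpos] at h2
  simp only [f, Finset.sum_add_distrib, Finset.sum_sub_distrib, Finset.sum_const,
    Finset.card_range, nsmul_eq_mul] at h1
  linarith

end LowerBound

/-! ### Chernoff bounds, minimax, and exhaustion of convex open sets. -/

section UpperBound

variable {E : Type*} [AddCommGroup E] [Module ℝ E] [TopologicalSpace E]
  [MeasurableSpace E] [BorelSpace E] {Ω : Type*} [MeasurableSpace Ω]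

/-- Chernoff's inequality for sample means. -/
lemma measure_le_map_sampleMean_le {P : Measure Ω} {ξ : ℕ → Ω → E} (hm : ∀ i, Measurable (ξ i))
    (hi : iIndepFun ξ P) (hid : ∀ i, IdentDistrib (ξ i) (ξ 0) P P) {ν : E →L[ℝ] ℝ} {r : ℝ}
    (hr : expIntegral (P.map (ξ 0)) Set.univ ν ≤ ENNReal.ofReal (Real.exp r)) (s : ℝ) (n : ℕ) :
    P {ω | s ≤ ν (sampleMean ξ n ω)} ≤ ENNReal.ofReal (Real.exp (n * (r - s))) := by
  have h1 := lintegral_prod_indicator_exp hm hi hid MeasurableSet.univ ν.continuous.measurable n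
  simp only [prod_indicator_exp_of_mem (K := Set.univ) ν (fun _ _ => Set.mem_univ _)] at h1
  have h2 := mul_meas_ge_le_lintegral₀ (μ := P)
    (f := fun ω => ENNReal.ofReal (Real.exp (∑ i ∈ Finset.range n, ν (ξ i ω)))) (by
      have : Measurable fun ω => ∑ i ∈ Finset.range n, ν (ξ i ω) :=
        Finset.measurable_sum _ fun i _ => ν.continuous.measurable.comp (hm i)
      fun_prop) (ENNReal.ofReal (Real.exp (n * s)))
  rw [h1] at h2
  have h3 : ENNReal.ofReal (Real.exp (n * s)) * P {ω | s ≤ ν (sampleMean ξ n ω)}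
      ≤ ENNReal.ofReal (Real.exp (n * s)) * ENNReal.ofReal (Real.exp (n * (r - s))) := by
    calc _ ≤ _ := mul_le_mul_right (measure_mono fun ω hω => ?_) _
      _ ≤ _ := h2
      _ ≤ ENNReal.ofReal (Real.exp r) ^ n := pow_le_pow_left' hr n
      _ = _ := by
        rw [← ENNReal.ofReal_pow (Real.exp_pos _).le, ← Real.exp_nat_mul,
          ← ENNReal.ofReal_mul (Real.exp_pos _).le, ← Real.exp_add]
        congr 2; ring
    refine ENNReal.ofReal_le_ofReal (Real.exp_le_exp.2 ?_)
    have hω' : s ≤ ν (sampleMean ξ n ω) := hω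
    rw [map_sampleMean] at hω'
    rcases eq_or_ne n 0 with rfl | hn
    · simp
    · have hn' : (0 : ℝ) < n := by positivity
      rwa [inv_mul_eq_div, le_div_iff₀' hn'] at hω'
  exact (ENNReal.mul_le_mul_iff_right (by simp [Real.exp_pos]) ENNReal.ofReal_ne_top).1 h3

/-- Convexity of `Λ`, obtained from Jensen for `exp` at the normalized exponents `ν j - r j`; this
replaces Hölder's inequality. -/
lemma expIntegral_sum_smul_le {ρ : Measure E} {ι : Type*} [Fintype ι] {ν : ι → E →L[ℝ] ℝ}
    {r l : ι → ℝ} (h : ∀ j, expIntegral ρ Set.univ (ν j) ≤ ENNReal.ofReal (Real.exp (r j)))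
    (hl : ∀ j, 0 ≤ l j) (hl1 : ∑ j, l j = 1) :
    expIntegral ρ Set.univ (∑ j, l j • ν j : E →L[ℝ] ℝ)
      ≤ ENNReal.ofReal (Real.exp (∑ j, l j * r j)) := by
  have hcancel : ∀ (a b : ℝ), ENNReal.ofReal (Real.exp (a + b))
      = ENNReal.ofReal (Real.exp a) * ENNReal.ofReal (Real.exp b) := fun a b => by
    rw [Real.exp_add, ENNReal.ofReal_mul (Real.exp_pos _).le]
  have hmeas : ∀ j, Measurable fun y => ENNReal.ofReal (Real.exp (ν j y)) := fun j => by
    have := (ν j).continuous.measurable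
    fun_prop
  have h1 : ∀ y, Real.exp ((∑ j, l j • ν j : E →L[ℝ] ℝ) y) ≤
      ∑ j, (Real.exp (∑ j, l j * r j) * (l j * Real.exp (-r j))) * Real.exp (ν j y) := by
    intro y
    have h2 := convexOn_exp.map_sum_le (t := Finset.univ) (w := l) (p := fun j => ν j y - r j)
      (fun j _ => hl j) hl1 (fun _ _ => Set.mem_univ _)
    simp only [smul_eq_mul] at h2
    calc Real.exp ((∑ j, l j • ν j : E →L[ℝ] ℝ) y)
        = Real.exp (∑ j, l j * r j) * Real.exp (∑ j, l j * (ν j y - r j)) := by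
          rw [← Real.exp_add]
          congr 1
          simp only [_root_.sum_apply, _root_.smul_apply, smul_eq_mul, mul_sub,
            Finset.sum_sub_distrib]
          ring
      _ ≤ _ := by
          refine (mul_le_mul_of_nonneg_left h2 (Real.exp_pos _).le).trans (le_of_eq ?_)
          rw [Finset.mul_sum]
          refine Finset.sum_congr rfl fun j _ => ?_
          rw [sub_eq_add_neg, Real.exp_add]
          ring
  have hnn : ∀ j, 0 ≤ Real.exp (∑ j, l j * r j) * (l j * Real.exp (-r j)) := fun j => by
    have := hl j
    positivity
  calc expIntegral ρ Set.univ (∑ j, l j • ν j : E →L[ℝ] ℝ)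
      ≤ ∫⁻ y, ∑ j, ENNReal.ofReal (Real.exp (∑ j, l j * r j) * (l j * Real.exp (-r j)))
          * ENNReal.ofReal (Real.exp (ν j y)) ∂ρ := by
        rw [expIntegral, Measure.restrict_univ]
        refine lintegral_mono fun y => ?_
        refine (ENNReal.ofReal_le_ofReal (h1 y)).trans (le_of_eq ?_)
        rw [ENNReal.ofReal_sum_of_nonneg fun j _ => mul_nonneg (hnn j) (Real.exp_pos _).le]
        exact Finset.sum_congr rfl fun j _ => ENNReal.ofReal_mul (hnn j)
    _ = ∑ j, ENNReal.ofReal (Real.exp (∑ j, l j * r j) * (l j * Real.exp (-r j)))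
          * expIntegral ρ Set.univ (ν j) := by
        rw [lintegral_finsetSum _ fun j _ => (hmeas j).const_mul _]
        refine Finset.sum_congr rfl fun j _ => ?_
        rw [lintegral_const_mul _ (hmeas j), expIntegral, Measure.restrict_univ]
    _ ≤ ∑ j, ENNReal.ofReal (Real.exp (∑ j, l j * r j) * (l j * Real.exp (-r j)))
          * ENNReal.ofReal (Real.exp (r j)) := by
        gcongr with j
        exact h j
    _ = _ := by
        simp only [← ENNReal.ofReal_mul (hnn _)]
        rw [← ENNReal.ofReal_sum_of_nonneg fun j _ => mul_nonneg (hnn j) (Real.exp_pos _).le]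
        congr 1
        calc _ = ∑ j, Real.exp (∑ j, l j * r j) * l j := by
              refine Finset.sum_congr rfl fun j _ => ?_
              rw [mul_assoc, mul_assoc, ← Real.exp_add]
              simp
          _ = _ := by rw [← Finset.mul_sum, hl1, mul_one]

/-- Minimax on a convex compact set: pointwise dual certificates combine to a single one. -/
lemma exists_forall_lt_of_isCompact {ρ : Measure E} {Q C : Set E} (hc : Convex ℝ C)
    (hC : IsCompact C) (hne : C.Nonempty) {α : ℝ}
    (h : ∀ y ∈ C, ∃ (ν : E →L[ℝ] ℝ) (r : ℝ), (∀ q ∈ Q, 0 ≤ ν q) ∧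
      expIntegral ρ Set.univ ν ≤ ENNReal.ofReal (Real.exp r) ∧ α < ν y - r) :
    ∃ (ν : E →L[ℝ] ℝ) (r : ℝ), (∀ q ∈ Q, 0 ≤ ν q) ∧
      expIntegral ρ Set.univ ν ≤ ENNReal.ofReal (Real.exp r) ∧ ∀ y ∈ C, α < ν y - r := by
  classical
  choose ν r hν hr hα using fun y : C => h y y.2
  obtain ⟨T, hT⟩ := hC.elim_finite_subcover (fun p : C => {y | α < ν p y - r p})
    (fun p => isOpen_lt continuous_const (by fun_prop))
    (fun p hp => Set.mem_iUnion.2 ⟨⟨p, hp⟩, hα ⟨p, hp⟩⟩)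
  -- The finite subcover says that the compact convex image `L(C)` misses the orthant below `r + α`.
  -- A separating functional must have one sign on the coordinates, since the orthant is unbounded
  -- downwards, and its normalized coefficients are the mixing weights.
  let L : E →L[ℝ] (T → ℝ) := ContinuousLinearMap.pi fun j => ν j
  obtain ⟨f, u, v, hu, huv, hv⟩ := geometric_hahn_banach_compact_closed
    (hc.is_linear_image L.toLinearMap.isLinear) (hC.image L.continuous)
    (convex_Iic (𝕜 := ℝ) (fun j : T => r j + α)) isClosed_Iic (by
      refine Set.disjoint_left.2 ?_
      rintro _ ⟨y, hy, rfl⟩ hle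
      obtain ⟨p, hpT, hp⟩ := Set.mem_iUnion₂.1 (hT hy)
      have h1 : ν p y ≤ r p + α := hle ⟨p, hpT⟩
      have h2 : α < ν p y - r p := hp
      linarith)
  let l : T → ℝ := fun j => -f (Pi.single j 1)
  have hfl : ∀ z : T → ℝ, f z = -∑ j, l j * z j := by
    intro z
    have h1 : z = ∑ j, z j • (Pi.single j (1 : ℝ) : T → ℝ) := pi_eq_sum_univ' z
    conv_lhs => rw [h1]
    rw [map_sum, ← Finset.sum_neg_distrib]
    refine Finset.sum_congr rfl fun j _ => ?_
    rw [map_smul, smul_eq_mul]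
    simp only [l]; ring
  have hl : ∀ j, 0 ≤ l j := by
    intro j
    by_contra! hneg
    set c := (|f (fun j : T => r j + α) - v| + 1) / f (Pi.single j 1)
    have hf0 : 0 < f (Pi.single j 1) := by simpa [l] using hneg
    have hc0 : 0 ≤ c := by positivity
    have h1 := hv ((fun j : T => r j + α) - c • Pi.single j (1 : ℝ)) (by
      refine Set.mem_Iic.2 (sub_le_self _ (smul_nonneg hc0 ?_))
      exact Pi.single_nonneg.2 zero_le_one)
    rw [map_sub, map_smul, smul_eq_mul, div_mul_cancel₀ _ hf0.ne'] at h1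
    linarith [le_abs_self (f (fun j : T => r j + α) - v)]
  have hmain : ∀ y ∈ C, ∑ j, l j * (r j + α) < ∑ j, l j * ν j y := by
    intro y hy
    have h1 := hu (L y) (Set.mem_image_of_mem L hy)
    have h2 := hv (fun j : T => r j + α) (Set.mem_Iic.2 le_rfl)
    rw [hfl] at h1 h2
    change -∑ j, l j * ν j y < u at h1
    linarith
  have hs0 : 0 < ∑ j, l j := by
    refine lt_of_le_of_ne (Finset.sum_nonneg fun j _ => hl j) fun h0 => ?_
    have h1 := (Finset.sum_eq_zero_iff_of_nonneg fun j _ => hl j).1 h0.symm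
    obtain ⟨y, hy⟩ := hne
    have h2 := hmain y hy
    simp [fun j => h1 j (Finset.mem_univ j)] at h2
  set s := ∑ j, l j
  have hl' : ∀ j, 0 ≤ l j / s := fun j => div_nonneg (hl j) hs0.le
  have hl1 : ∑ j, l j / s = 1 := by rw [← Finset.sum_div, div_self hs0.ne']
  refine ⟨∑ j, (l j / s) • ν j, ∑ j, l j / s * r j, fun q hq => ?_,
    expIntegral_sum_smul_le (fun j => hr j) hl' hl1, fun y hy => ?_⟩
  · simp only [_root_.sum_apply, _root_.smul_apply, smul_eq_mul]
    exact Finset.sum_nonneg fun j _ => mul_nonneg (hl' j) (hν j q hq)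
  · have h1 := div_lt_div_of_pos_right (hmain y hy) hs0
    have h2 : (∑ j, l j * (r j + α)) / s = ∑ j, l j / s * r j + α := by
      calc _ = ∑ j, (l j / s * r j + l j / s * α) := by
            rw [Finset.sum_div]
            exact Finset.sum_congr rfl fun j _ => by ring
        _ = _ := by rw [Finset.sum_add_distrib, ← Finset.sum_mul, hl1, one_mul]
    have h3 : (∑ j, l j * ν j y) / s = (∑ j, (l j / s) • ν j : E →L[ℝ] ℝ) y := by
      simp only [_root_.sum_apply, _root_.smul_apply, smul_eq_mul, Finset.sum_div]
      exact Finset.sum_congr rfl fun j _ => by ring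
    rw [h2, h3] at h1
    linarith

lemma measure_sampleMean_isCompact_le {P : Measure Ω} {ξ : ℕ → Ω → E}
    (hm : ∀ i, Measurable (ξ i)) (hi : iIndepFun ξ P)
    (hid : ∀ i, IdentDistrib (ξ i) (ξ 0) P P) {Q C : Set E} (hc : Convex ℝ C)
    (hC : IsCompact C) {α : ℝ}
    (h : ∀ y ∈ C, ∃ (ν : E →L[ℝ] ℝ) (r : ℝ), (∀ q ∈ Q, 0 ≤ ν q) ∧
      expIntegral (P.map (ξ 0)) Set.univ ν ≤ ENNReal.ofReal (Real.exp r) ∧ α < ν y - r) (n : ℕ) :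
    P (sampleMean ξ n ⁻¹' C) ≤ ENNReal.ofReal (Real.exp (n * -α)) := by
  rcases C.eq_empty_or_nonempty with rfl | hne
  · simp
  obtain ⟨ν, r, -, hr, hα⟩ := exists_forall_lt_of_isCompact hc hC hne h
  refine (measure_mono fun ω hω => ?_).trans
    ((measure_le_map_sampleMean_le hm hi hid hr (r + α) n).trans (le_of_eq ?_))
  · have := hα _ hω
    simp only [Set.mem_ofPred_eq]
    linarith
  · congr 3; ring

/-- `K` need not be convex, so a union bound over the cover replaces the minimax. Positivity of each
`ν` extends its half-space from `K` to `↑K`; the prefactor `N` disappears at exponential scale. -/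
lemma measure_sampleMean_upperClosure_le {P : Measure Ω} {ξ : ℕ → Ω → E}
    (hm : ∀ i, Measurable (ξ i)) (hi : iIndepFun ξ P)
    (hid : ∀ i, IdentDistrib (ξ i) (ξ 0) P P) [Preorder E] {Q K : Set E}
    (hQ : ∀ x y : E, x ≤ y → y - x ∈ Q) (hK : IsCompact K) {α : ℝ}
    (h : ∀ y ∈ K, ∃ (ν : E →L[ℝ] ℝ) (r : ℝ), (∀ q ∈ Q, 0 ≤ ν q) ∧
      expIntegral (P.map (ξ 0)) Set.univ ν ≤ ENNReal.ofReal (Real.exp r) ∧ α < ν y - r) :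
    ∃ N : ℕ, ∀ n, P (sampleMean ξ n ⁻¹' {y | ∃ x ∈ K, x ≤ y})
      ≤ N * ENNReal.ofReal (Real.exp (n * -α)) := by
  choose ν r hν hr hα using fun y : K => h y y.2
  obtain ⟨T, hT⟩ := hK.elim_finite_subcover (fun p : K => {y | α < ν p y - r p})
    (fun p => isOpen_lt continuous_const (by fun_prop))
    (fun p hp => Set.mem_iUnion.2 ⟨⟨p, hp⟩, hα ⟨p, hp⟩⟩)
  refine ⟨T.card, fun n => ?_⟩
  calc _ ≤ P (⋃ p ∈ T, {ω | r p + α ≤ ν p (sampleMean ξ n ω)}) := by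
        refine measure_mono fun ω hω => ?_
        obtain ⟨x, hx, hxy⟩ := hω
        obtain ⟨p, hpT, hp⟩ := Set.mem_iUnion₂.1 (hT hx)
        refine Set.mem_iUnion₂.2 ⟨p, hpT, ?_⟩
        have h1 := hν p _ (hQ _ _ hxy)
        rw [map_sub] at h1
        have h2 : α < ν p x - r p := hp
        simp only [Set.mem_ofPred_eq]
        linarith
    _ ≤ ∑ p ∈ T, P {ω | r p + α ≤ ν p (sampleMean ξ n ω)} := measure_biUnion_finset_le _ _
    _ ≤ ∑ _p ∈ T, ENNReal.ofReal (Real.exp (n * -α)) := by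
        refine Finset.sum_le_sum fun p _ => ?_
        refine (measure_le_map_sampleMean_le hm hi hid (hr p) (r p + α) n).trans (le_of_eq ?_)
        congr 3; ring
    _ = _ := by rw [Finset.sum_const, nsmul_eq_mul]

variable [IsTopologicalAddGroup E] [ContinuousSMul ℝ E]

/-- A convex open set is an increasing union of closed convex sets. -/
lemma Convex.exists_monotone_isClosed_iUnion_eq {E : Type*} [AddCommGroup E] [Module ℝ E]
    [TopologicalSpace E] [IsTopologicalAddGroup E] [ContinuousSMul ℝ E] {O : Set E}
    (hc : Convex ℝ O) (hO : IsOpen O) :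
    ∃ F : ℕ → Set E, Monotone F ∧ (∀ n, IsClosed (F n)) ∧ (∀ n, Convex ℝ (F n)) ∧
      ⋃ n, F n = O := by
  rcases O.eq_empty_or_nonempty with rfl | ⟨x, hx⟩
  · exact ⟨fun _ => ∅, monotone_const, fun _ => isClosed_empty, fun _ => convex_empty, by simp⟩
  -- `F n` is the closure of `O` contracted towards `x` by `1 / t n`. Contraction towards an
  -- interior point moves the closure into `O`, and `t n ↓ 1` exhausts it.
  let t : ℕ → ℝ := fun n => 1 + 1 / ((n : ℝ) + 1)
  have ht : ∀ n, 1 < t n := fun n => by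
    simp only [t]; linarith [Nat.one_div_pos_of_nat (α := ℝ) (n := n)]
  have htanti : Antitone t := fun m n hmn => by
    simp only [t]; linarith [Nat.one_div_le_one_div (α := ℝ) hmn]
  have hseg : ∀ (s : ℝ) (_ : 0 < s) (y : E), s⁻¹ • (x + s • (y - x)) + (1 - s⁻¹) • x = y := by
    intro s hs y
    rw [smul_add, smul_smul, inv_mul_cancel₀ hs.ne']
    module
  refine ⟨fun n => {y | x + t n • (y - x) ∈ closure O}, fun m n hmn y hy => ?_,
    fun n => isClosed_closure.preimage (by fun_prop), fun n => ?_, ?_⟩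
  · have h1 : x + t n • (y - x) = (t n / t m) • (x + t m • (y - x)) + (1 - t n / t m) • x := by
      have : t n = (t n / t m) * t m := by field_simp [(zero_lt_one.trans (ht m)).ne']
      rw [smul_add, smul_smul, ← this]
      module
    have h2 : t n / t m ≤ 1 := (div_le_one (zero_lt_one.trans (ht m))).2 (htanti hmn)
    change x + t n • (y - x) ∈ closure O
    rw [h1]
    exact hc.closure hy (subset_closure hx)
      (div_nonneg (zero_lt_one.trans (ht n)).le (zero_lt_one.trans (ht m)).le)
      (sub_nonneg.2 h2) (by ring)
  · intro y hy z hz a b ha hb hab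
    have h1 : x + t n • (a • y + b • z - x)
        = a • (x + t n • (y - x)) + b • (x + t n • (z - x)) := by
      obtain rfl : b = 1 - a := by linarith
      module
    change x + t n • (a • y + b • z - x) ∈ closure O
    rw [h1]
    exact hc.closure hy hz ha hb hab
  · ext y
    rw [Set.mem_iUnion]
    constructor
    · rintro ⟨n, hn⟩
      have h1 := hc.combo_closure_interior_mem_interior hn (hO.interior_eq.symm ▸ hx)
        (a := (t n)⁻¹) (b := 1 - (t n)⁻¹) (inv_nonneg.2 (zero_lt_one.trans (ht n)).le)
        (sub_pos.2 (inv_lt_one_of_one_lt₀ (ht n))) (by ring)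
      rw [hseg _ (zero_lt_one.trans (ht n))] at h1
      exact interior_subset h1
    · intro hy
      have h1 : Tendsto (fun n => x + t n • (y - x)) atTop (𝓝 (x + (1 + 0 : ℝ) • (y - x))) := by
        refine tendsto_const_nhds.add (Tendsto.smul_const ?_ _)
        exact tendsto_const_nhds.add tendsto_one_div_add_atTop_nhds_zero_nat
      rw [show x + (1 + 0 : ℝ) • (y - x) = y by module] at h1
      obtain ⟨n, hn⟩ := (h1.eventually (hO.mem_nhds hy)).exists
      exact ⟨n, subset_closure hn⟩

lemma measure_sampleMean_isOpen_le [T2Space E] {P : Measure Ω} [IsProbabilityMeasure P]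
    {ξ : ℕ → Ω → E}
    (hm : ∀ i, Measurable (ξ i)) (hi : iIndepFun ξ P)
    (hid : ∀ i, IdentDistrib (ξ i) (ξ 0) P P) {Q O : Set E} (hc : Convex ℝ O)
    (hO : IsOpen O) {α : ℝ}
    (h : ∀ y ∈ O, ∃ (ν : E →L[ℝ] ℝ) (r : ℝ), (∀ q ∈ Q, 0 ≤ ν q) ∧
      expIntegral (P.map (ξ 0)) Set.univ ν ≤ ENNReal.ofReal (Real.exp r) ∧ α < ν y - r) {n : ℕ}
    (hX : Measurable (sampleMean ξ n)) (htight : IsConvexTight P (sampleMean ξ n)) :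
    P (sampleMean ξ n ⁻¹' O) ≤ ENNReal.ofReal (Real.exp (n * -α)) := by
  obtain ⟨F, hFm, hFcl, hFc, hFO⟩ := hc.exists_monotone_isClosed_iUnion_eq hO
  refine ENNReal.le_of_forall_pos_le_add fun ε hε _ => ?_
  obtain ⟨K, hKc, hK, hKP⟩ := htight ε hε
  have hmeas : MeasurableSet (sampleMean ξ n ⁻¹' K) := hX hK.measurableSet
  -- The sets `F m ∩ K` are convex, compact and increase to `O ∩ K`. Since the compact bound has no
  -- prefactor it passes to the limit in `m`.
  have h1 : P (sampleMean ξ n ⁻¹' (O ∩ K)) ≤ ENNReal.ofReal (Real.exp (n * -α)) := by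
    have h2 : sampleMean ξ n ⁻¹' (O ∩ K) = ⋃ m, sampleMean ξ n ⁻¹' (F m ∩ K) := by
      rw [← hFO, Set.iUnion_inter, Set.preimage_iUnion]
    rw [h2]
    refine le_of_tendsto' (tendsto_measure_iUnion_atTop fun a b hab =>
      Set.preimage_mono (Set.inter_subset_inter_left _ (hFm hab))) fun m => ?_
    refine measure_sampleMean_isCompact_le hm hi hid ((hFc m).inter hKc)
      (hK.inter_left (hFcl m)) (fun y hy => h y ?_) n
    rw [← hFO]
    exact Set.mem_iUnion.2 ⟨m, hy.1⟩
  calc P (sampleMean ξ n ⁻¹' O)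
      ≤ P (sampleMean ξ n ⁻¹' (O ∩ K)) + P (sampleMean ξ n ⁻¹' K)ᶜ := by
        refine (measure_mono fun ω hω => ?_).trans (measure_union_le _ _)
        by_cases hωK : sampleMean ξ n ω ∈ K
        exacts [Or.inl ⟨hω, hωK⟩, Or.inr hωK]
    _ ≤ _ := by
        refine add_le_add h1 ?_
        rw [prob_compl_eq_one_sub hmeas]
        simpa using tsub_le_iff_tsub_le.1 hKP

end UpperBound

/-! ### Translating between extended-real rates and probabilities. -/

section ExtendedReals

lemma ENNReal.log_le_coe_iff {p : ℝ≥0∞} {a : ℝ} :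
    ENNReal.log p ≤ a ↔ p ≤ ENNReal.ofReal (Real.exp a) := by
  rw [← ENNReal.log_le_log_iff, ENNReal.log_ofReal_of_pos (Real.exp_pos _), Real.log_exp]

lemma ENNReal.coe_le_log_iff {p : ℝ≥0∞} {a : ℝ} :
    a ≤ ENNReal.log p ↔ ENNReal.ofReal (Real.exp a) ≤ p := by
  rw [← ENNReal.log_le_log_iff, ENNReal.log_ofReal_of_pos (Real.exp_pos _), Real.log_exp]

lemma EReal.inv_natCast_mul_le_iff {n : ℕ} (hn : n ≠ 0) {L : EReal} {a : ℝ} :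
    (((n : ℝ)⁻¹ : ℝ) : EReal) * L ≤ a ↔ L ≤ ((n * a : ℝ) : EReal) := by
  have hn' : (0 : ℝ) < n := by positivity
  induction L with
  | bot => rw [EReal.coe_mul_bot_of_pos (inv_pos.2 hn')]; simp
  | top => rw [EReal.coe_mul_top_of_pos (inv_pos.2 hn')]; simp only [top_le_iff, EReal.coe_ne_top]
  | coe y =>
    rw [← EReal.coe_mul, EReal.coe_le_coe_iff, EReal.coe_le_coe_iff, inv_mul_eq_div,
      div_le_iff₀' hn']

lemma EReal.le_inv_natCast_mul_iff {n : ℕ} (hn : n ≠ 0) {L : EReal} {a : ℝ} :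
    a ≤ (((n : ℝ)⁻¹ : ℝ) : EReal) * L ↔ ((n * a : ℝ) : EReal) ≤ L := by
  have hn' : (0 : ℝ) < n := by positivity
  induction L with
  | bot => rw [EReal.coe_mul_bot_of_pos (inv_pos.2 hn')]; simp only [le_bot_iff, EReal.coe_ne_bot]
  | top => rw [EReal.coe_mul_top_of_pos (inv_pos.2 hn')]; simp
  | coe y =>
    rw [← EReal.coe_mul, EReal.coe_le_coe_iff, EReal.coe_le_coe_iff, inv_mul_eq_div,
      le_div_iff₀' hn']

lemma scaledLogProb_le_iff {E Ω : Type*} [MeasurableSpace Ω] {P : Measure Ω} {n : ℕ} (hn : n ≠ 0)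
    {Y : Ω → E} {A : Set E} {a : ℝ} :
    scaledLogProb P n Y A ≤ a ↔ P (Y ⁻¹' A) ≤ ENNReal.ofReal (Real.exp (n * a)) := by
  rw [scaledLogProb, EReal.inv_natCast_mul_le_iff hn, ENNReal.log_le_coe_iff]

lemma le_scaledLogProb_iff {E Ω : Type*} [MeasurableSpace Ω] {P : Measure Ω} {n : ℕ} (hn : n ≠ 0)
    {Y : Ω → E} {A : Set E} {a : ℝ} :
    a ≤ scaledLogProb P n Y A ↔ ENNReal.ofReal (Real.exp (n * a)) ≤ P (Y ⁻¹' A) := by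
  rw [scaledLogProb, EReal.le_inv_natCast_mul_iff hn, ENNReal.coe_le_log_iff]

lemma EReal.le_neg_of_forall_lt {X I : EReal}
    (h : ∀ α : ℝ, (α : EReal) < I → X ≤ ((-α : ℝ) : EReal)) : X ≤ -I := by
  rw [EReal.le_neg]
  refine EReal.ge_of_forall_gt_iff_ge.1 fun α hα => ?_
  rw [EReal.le_neg, ← EReal.coe_neg]
  exact h α hα

end ExtendedReals

/-! ### Identification of the minimal rate function and the main theorem. -/

section MonotoneCramer

/-- The conjugate of `logMGF` over the functionals that are nonnegative on `Epos`. -/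
noncomputable def positiveConjugate {E : Type*} [AddCommGroup E] [Module ℝ E] [TopologicalSpace E]
    (Epos : ProperCone ℝ E) {Ω : Type*} [MeasurableSpace Ω] (P : Measure Ω) (Y : Ω → E) (x : E) :
    EReal :=
  ⨆ (μ : E →L[ℝ] ℝ) (_ : ∀ y ∈ Epos, 0 ≤ μ y), ((μ x : ℝ) : EReal) - logMGF P Y μ

variable {E : Type*} [AddCommGroup E] [Module ℝ E] [TopologicalSpace E]
  [MeasurableSpace E] [BorelSpace E] {Ω : Type*} [MeasurableSpace Ω]

lemma logMGF_eq {P : Measure Ω} {Y : Ω → E} (hY : Measurable Y) (ν : E →L[ℝ] ℝ) :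
    logMGF P Y ν = ENNReal.log (expIntegral (P.map Y) Set.univ ν) := by
  have := ν.continuous.measurable
  rw [logMGF, expIntegral, Measure.restrict_univ, lintegral_map (by fun_prop) hY]

lemma lt_expIntegral_of_positiveConjugate_lt {Epos : ProperCone ℝ E} {P : Measure Ω} {Y : Ω → E}
    (hY : Measurable Y) {x : E} {γ : ℝ} (h : positiveConjugate Epos P Y x < γ) (ν : E →L[ℝ] ℝ)
    (hν : ∀ y ∈ Epos, 0 ≤ ν y) :
    ENNReal.ofReal (Real.exp (ν x + -γ)) < expIntegral (P.map Y) Set.univ ν := by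
  by_contra! hcon
  rw [← ENNReal.log_le_coe_iff, ← logMGF_eq hY] at hcon
  have h1 : ((ν x : ℝ) : EReal) - logMGF P Y ν ≤ positiveConjugate Epos P Y x :=
    le_iSup₂_of_le ν hν le_rfl
  have h2 := (EReal.sub_le_sub (le_refl ((ν x : ℝ) : EReal)) hcon).trans_lt (h1.trans_lt h)
  rw [← EReal.coe_sub, EReal.coe_lt_coe_iff] at h2
  linarith

lemma exists_of_lt_positiveConjugate {Epos : ProperCone ℝ E} {P : Measure Ω} {Y : Ω → E}
    (hY : Measurable Y) {x : E} {α : ℝ} (h : α < positiveConjugate Epos P Y x) :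
    ∃ (ν : E →L[ℝ] ℝ) (r : ℝ), (∀ q ∈ (Epos : Set E), 0 ≤ ν q) ∧
      expIntegral (P.map Y) Set.univ ν ≤ ENNReal.ofReal (Real.exp r) ∧ α < ν x - r := by
  simp only [positiveConjugate, lt_iSup_iff] at h
  obtain ⟨ν, hν, h⟩ := h
  obtain ⟨s, hs1, hs2⟩ := EReal.lt_iff_exists_real_btwn.1 h
  refine ⟨ν, ν x - s, hν, ?_, by rw [EReal.coe_lt_coe_iff] at hs1; linarith⟩
  rw [← ENNReal.log_le_coe_iff, ← logMGF_eq hY]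
  by_contra! hcon
  have h1 := EReal.sub_le_sub (le_refl ((ν x : ℝ) : EReal)) hcon.le
  rw [← EReal.coe_sub, sub_sub_cancel] at h1
  exact hs2.not_ge h1

lemma limsup_le_of_measure_le {E Ω : Type*} [MeasurableSpace Ω] {P : Measure Ω}
    {Y : ℕ → Ω → E} {A : Set E} {α : EReal}
    (h : ∀ a : ℝ, (a : EReal) < α → ∃ N : ℕ, ∀ᶠ n : ℕ in atTop,
      P (Y n ⁻¹' A) ≤ N * ENNReal.ofReal (Real.exp (n * -a))) :
    limsup (fun n : ℕ => scaledLogProb P n (Y n) A) atTop ≤ -α := by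
  refine EReal.le_neg_of_forall_lt fun a ha => ?_
  obtain ⟨b, hb1, hb2⟩ := EReal.lt_iff_exists_real_btwn.1 ha
  rw [EReal.coe_lt_coe_iff] at hb1
  obtain ⟨N, hN⟩ := h b hb2
  refine limsup_le_of_le (h := ?_)
  -- The slack between `a` and `b` absorbs the prefactor, as `exp(n(b - a))` eventually exceeds `N`.
  have h1 : Tendsto (fun n : ℕ => (n : ℝ) * (b - a)) atTop atTop :=
    tendsto_natCast_atTop_atTop.atTop_mul_const (sub_pos.2 hb1)
  filter_upwards [hN, eventually_ne_atTop 0, h1.eventually_ge_atTop (N : ℝ)] with n hn hn0 hnN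
  rw [scaledLogProb_le_iff hn0]
  refine hn.trans ?_
  rw [← ENNReal.ofReal_natCast, ← ENNReal.ofReal_mul (Nat.cast_nonneg N)]
  refine ENNReal.ofReal_le_ofReal ?_
  have h2 : (N : ℝ) ≤ Real.exp (n * (b - a)) := by
    linarith [Real.add_one_le_exp ((n : ℝ) * (b - a))]
  calc _ ≤ Real.exp (n * (b - a)) * Real.exp (n * -b) := by gcongr
    _ = _ := by rw [← Real.exp_add]; congr 1; ring

/-- A positive `ν` is itself a test function in `L↑`, and Chernoff gives `c + J_{ν > c} ≤ Λ(ν)` for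
every `c`. -/
lemma positiveConjugate_le_minimalRate [Preorder E] {Epos : ProperCone ℝ E}
    (hle : ∀ x y : E, x ≤ y ↔ y - x ∈ Epos) {P : Measure Ω}
    {ξ : ℕ → Ω → E} (hm : ∀ i, Measurable (ξ i)) (hi : iIndepFun ξ P)
    (hid : ∀ i, IdentDistrib (ξ i) (ξ 0) P P) (x : E) :
    positiveConjugate Epos P (ξ 0) x ≤ minimalRate (sampleConcentration P ξ) x := by
  refine iSup₂_le fun ν hν => ?_
  have hmem : (fun y => ((ν y : ℝ) : EReal)) ∈ lscIncreasing E := by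
    refine ⟨fun a b hab => ?_, ?_, fun y => EReal.coe_ne_top _⟩
    · have := hν _ ((hle a b).1 hab)
      rw [map_sub] at this
      exact EReal.coe_le_coe_iff.2 (by linarith)
    · exact (continuous_coe_real_ereal.comp ν.continuous).lowerSemicontinuous
  refine le_iSup₂_of_le _ hmem (EReal.sub_le_sub le_rfl (iSup_le fun c => ?_))
  refine EReal.le_of_forall_lt_iff_le.1 fun r hr => ?_
  have hr' := hr.le
  rw [logMGF_eq (hm 0), ENNReal.log_le_coe_iff] at hr'
  have hJ : sampleConcentration P ξ {x | (c : EReal) < ((ν x : ℝ) : EReal)}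
      ≤ ((r - c : ℝ) : EReal) := by
    refine limsup_le_of_le (h := ?_)
    filter_upwards [eventually_ne_atTop 0] with n hn0
    rw [scaledLogProb_le_iff hn0]
    refine (measure_mono fun ω hω => ?_).trans (measure_le_map_sampleMean_le hm hi hid hr' c n)
    exact (EReal.coe_lt_coe_iff.1 hω).le
  calc _ ≤ (c : EReal) + ((r - c : ℝ) : EReal) := by gcongr
    _ = r := by rw [← EReal.coe_add, add_sub_cancel]

variable [IsTopologicalAddGroup E] [ContinuousSMul ℝ E] [LocallyConvexSpace ℝ E] [T2Space E]
  [Preorder E]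

lemma eventually_le_scaledLogProb {Epos : ProperCone ℝ E}
    (hle : ∀ x y : E, x ≤ y ↔ y - x ∈ Epos) {P : Measure Ω} [IsProbabilityMeasure P]
    {ξ : ℕ → Ω → E} (hm : ∀ i, Measurable (ξ i)) (hi : iIndepFun ξ P)
    (hid : ∀ i, IdentDistrib (ξ i) (ξ 0) P P) (htight : IsConvexTight P (ξ 0))
    {O : Set E} (hO : IsOpen O) (hOu : IsUpperSet O) (hOc : Convex ℝ O) {x : E} (hx : x ∈ O)
    {γ : ℝ} (hγ : positiveConjugate Epos P (ξ 0) x < γ) :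
    ∀ᶠ n : ℕ in atTop, ((-γ : ℝ) : EReal) ≤ scaledLogProb P n (sampleMean ξ n) O := by
  filter_upwards [eventually_le_measure_sampleMean Epos hle hm hi hid htight hO hOu hOc hx
    (lt_expIntegral_of_positiveConjugate_lt (hm 0) hγ), eventually_ne_atTop 0] with n hn hn0
  exact (le_scaledLogProb_iff hn0).2 hn

open scoped Pointwise in
-- Add the cone to a convex neighbourhood inside `U`; the sum stays in `U` because `U` is an upset.
lemma exists_convex_isOpen_isUpperSet_subset {E : Type*} [AddCommGroup E] [Module ℝ E]
    [TopologicalSpace E] [IsTopologicalAddGroup E] [ContinuousSMul ℝ E] [LocallyConvexSpace ℝ E]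
    [Preorder E] (Epos : ProperCone ℝ E)
    (hle : ∀ x y : E, x ≤ y ↔ y - x ∈ Epos) {U : Set E} (hU : IsOpen U) (hUu : IsUpperSet U)
    {x : E} (hx : x ∈ U) :
    ∃ O ⊆ U, IsOpen O ∧ IsUpperSet O ∧ Convex ℝ O ∧ x ∈ O := by
  obtain ⟨V, hVx, hVc, hVU⟩ :=
    (locallyConvexSpace_iff_exists_convex_subset ℝ E).1 inferInstance x U (hU.mem_nhds hx)
  refine ⟨interior V + (Epos : Set E), ?_, isOpen_interior.add_right, ?_, ?_, ?_⟩
  · rintro _ ⟨v, hv, q, hq, rfl⟩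
    refine hUu ((hle v _).2 ?_) (hVU (interior_subset hv))
    simpa using hq
  · rintro _ b hb ⟨v, hv, q, hq, rfl⟩
    refine ⟨v, hv, b - v, ?_, by simp⟩
    have h1 : b - v = (b - (v + q)) + q := by abel
    rw [h1]
    exact Epos.add_mem ((hle _ _).1 hb) hq
  · refine hVc.interior.add ?_
    intro y hy z hz a b ha hb _
    exact Epos.add_mem (Epos.smul_mem hy ha) (Epos.smul_mem hz hb)
  · exact ⟨x, mem_interior_iff_mem_nhds.2 hVx, 0, Epos.zero_mem, add_zero x⟩

/-- For `c < f(x)` the lower bound on a convex open upset inside `{f > c}` gives `J_{f > c} ≥ -γ`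
whenever `γ > Λ*(x)`. Hence `φ_J(f) ≥ c - γ`, and `c` may tend to `f(x)`. -/
lemma minimalRate_le_positiveConjugate {Epos : ProperCone ℝ E}
    (hle : ∀ x y : E, x ≤ y ↔ y - x ∈ Epos) {P : Measure Ω} [IsProbabilityMeasure P]
    {ξ : ℕ → Ω → E} (hm : ∀ i, Measurable (ξ i)) (hi : iIndepFun ξ P)
    (hid : ∀ i, IdentDistrib (ξ i) (ξ 0) P P) (htight : IsConvexTight P (ξ 0)) (x : E) :
    minimalRate (sampleConcentration P ξ) x ≤ positiveConjugate Epos P (ξ 0) x := by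
  refine iSup₂_le fun f ⟨hfm, hfl, _⟩ => EReal.le_of_forall_lt_iff_le.1 fun γ hγ => ?_
  refine EReal.sub_le_of_le_add (EReal.ge_of_forall_gt_iff_ge.1 fun c hc => ?_)
  have hJ : ((-γ : ℝ) : EReal) ≤ sampleConcentration P ξ {x | (c : EReal) < f x} := by
    obtain ⟨O, hOU, hO, hOu, hOc, hxO⟩ := exists_convex_isOpen_isUpperSet_subset Epos hle
      (hfl.isOpen_preimage c) (fun a b hab ha => lt_of_lt_of_le ha (hfm hab)) hc
    refine le_limsup_of_frequently_le (Eventually.frequently ?_)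
    filter_upwards [eventually_le_scaledLogProb hle hm hi hid htight hO hOu hOc hxO hγ,
      eventually_ne_atTop 0] with n hn hn0
    rw [le_scaledLogProb_iff hn0] at hn ⊢
    exact hn.trans (measure_mono (Set.preimage_mono hOU))
  have h1 : ((c - γ : ℝ) : EReal) ≤ maxitiveIntegral (sampleConcentration P ξ) f := by
    refine le_iSup_of_le c ?_
    rw [sub_eq_add_neg, EReal.coe_add]
    gcongr
  calc (c : EReal) = (γ : EReal) + ((c - γ : ℝ) : EReal) := by
        rw [← EReal.coe_add, add_sub_cancel]
    _ ≤ _ := by gcongr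

end MonotoneCramer

/-- Monotone Cramér theorem. -/
theorem mainTheorem4
    {E : Type*} [AddCommGroup E] [Module ℝ E] [TopologicalSpace E] [IsTopologicalAddGroup E]
    [ContinuousSMul ℝ E] [LocallyConvexSpace ℝ E] [T2Space E] [MeasurableSpace E] [BorelSpace E]
    -- the preorder of `E` is the one induced by the closed convex cone `Epos`
    [Preorder E] (Epos : ProperCone ℝ E) (hle : ∀ x y : E, x ≤ y ↔ y - x ∈ Epos)
    {Ω : Type*} [MeasurableSpace Ω] (P : Measure Ω) [IsProbabilityMeasure P]
    (ξ : ℕ → Ω → E) (hξ_meas : ∀ i, Measurable (ξ i))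
    (hX_meas : ∀ n, Measurable (sampleMean ξ n))
    (hξ_indep : iIndepFun ξ P) (hξ_ident : ∀ i, IdentDistrib (ξ i) (ξ 0) P P)
    (hξ_tight : IsConvexTight P (ξ 0)) :
    (∀ x : E, minimalRate (sampleConcentration P ξ) x
        = ⨆ (μ : E →L[ℝ] ℝ) (_ : ∀ y ∈ Epos, 0 ≤ μ y), ((μ x : ℝ) : EReal) - logMGF P (ξ 0) μ) ∧
    (∀ C : Set E, IsClosed C → IsUpperSet C → IsCompactlyGeneratedUpset C →
        limsup (fun n : ℕ => scaledLogProb P n (sampleMean ξ n) C) atTop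
          ≤ -⨅ x ∈ C, minimalRate (sampleConcentration P ξ) x) ∧
    ((∀ n : ℕ, 1 ≤ n → IsConvexTight P (sampleMean ξ n)) →
      ∀ O : Set E, IsOpen O → IsUpperSet O → Convex ℝ O →
        Tendsto (fun n : ℕ => scaledLogProb P n (sampleMean ξ n) O) atTop
          (𝓝 (-⨅ x ∈ O, minimalRate (sampleConcentration P ξ) x))) := by
  have hI : ∀ x : E, minimalRate (sampleConcentration P ξ) x = positiveConjugate Epos P (ξ 0) x :=
    fun x => le_antisymm
      (minimalRate_le_positiveConjugate hle hξ_meas hξ_indep hξ_ident hξ_tight x)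
      (positiveConjugate_le_minimalRate hle hξ_meas hξ_indep hξ_ident x)
  -- Every level below the infimum of the rate is certified at each point of `A` by one positive
  -- functional; both upper bounds start from these certificates.
  have hcert : ∀ {A : Set E} {a : ℝ},
      (a : EReal) < ⨅ x ∈ A, minimalRate (sampleConcentration P ξ) x → ∀ y ∈ A,
      ∃ (ν : E →L[ℝ] ℝ) (r : ℝ), (∀ q ∈ (Epos : Set E), 0 ≤ ν q) ∧
        expIntegral (P.map (ξ 0)) Set.univ ν ≤ ENNReal.ofReal (Real.exp r) ∧ a < ν y - r := by
    intro A a ha y hy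
    refine exists_of_lt_positiveConjugate (hξ_meas 0) (ha.trans_le ?_)
    rw [← hI y]
    exact iInf₂_le y hy
  refine ⟨hI, ?_, fun hX_tight O hO hOu hOc => ?_⟩
  · rintro C - - ⟨K, hK, rfl⟩
    refine limsup_le_of_measure_le fun a ha => ?_
    obtain ⟨N, hN⟩ := measure_sampleMean_upperClosure_le hξ_meas hξ_indep hξ_ident
      (fun x y h => (hle x y).1 h) hK fun y hy => hcert ha y ⟨y, hy, le_rfl⟩
    exact ⟨N, Eventually.of_forall hN⟩
  · refine tendsto_of_le_liminf_of_limsup_le ?_ ?_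
    · rw [EReal.neg_le]
      refine le_iInf₂ fun x hx => EReal.le_of_forall_lt_iff_le.1 fun γ hγ => ?_
      rw [EReal.neg_le, ← EReal.coe_neg]
      rw [hI] at hγ
      exact le_liminf_of_le (h := eventually_le_scaledLogProb hle hξ_meas hξ_indep hξ_ident
        hξ_tight hO hOu hOc hx hγ)
    · refine limsup_le_of_measure_le fun a ha => ⟨1, ?_⟩
      filter_upwards [eventually_ge_atTop 1] with n hn
      rw [Nat.cast_one, one_mul]
      exact measure_sampleMean_isOpen_le hξ_meas hξ_indep hξ_ident hOc hO (hcert ha)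
        (hX_meas n) (hX_tight n hn)
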